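/- Let $K$ be a field, $n\ge 2$ an integer, and $R_n$ the rose with $n$ petals: the graph with one vertex $v$ and $n$ loops $e_1,\dots,e_n$. Its Leavitt path algebra $L=L_K(R_n)$ is the unital $K$-algebra (with $1=v$) generated by $e_1,\dots,e_n,e_1^*,\dots,e_n^*$ subject to $e_i^*e_j=\delta_{i,j}v$ and $\sum_{i=1}^n e_ie_i^*=v$. A closed path is a nonempty finite word in the petals; it is simple if it is not a power $d^m$, $m\ge 2$, of a closed path $d$. An infinite path is an infinite word $e_{k_1}e_{k_2}\cdots$. Two infinite paths are tail-equivalent, $\alpha\sim\beta$, if they become equal after deleting a finite initial part of each. An infinite path is irrational if it is not tail-equivalent to $c^\infty=ccc\cdots$ for any closed path $c$. Let $\mathrm{Irr}(K[x])$ be the set of irreducible polynomials of the form $1-a_1x-\cdots-a_sx^s$ in $K[x]$. - For an infinite path $\alpha$, let $V_{[\alpha]}$ be the $K$-vector space with basis $\{q : q\sim\alpha\}$ and the left $L$-action $e_i\cdot q=e_iq$, and $e_i^*\cdot q=q'$ if $q=e_iq'$, $e_i^*\cdot q=0$ if $q$ does not start with $e_i$. - For a simple closed path $c$ and $f\in\mathrm{Irr}(K[x])$,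 let $S^f_c=L/Lf(c)$ be the left $L$-module generated by one element $z$ subject to $f(c)z=0$. Let $\Pi_c$ be the set of cyclic rotations of $c$; up to isomorphism $S^f_c$ depends only on $f$ and $\Pi_c$, and $S^f_{\Pi_c}$ denotes any module isomorphic to it. - Let $A=A_{R_n}(e_1,e_2)$ be the $K$-subalgebra of $L$ generated by $v,e_1,e_3,\dots,e_n,e_2^*,\dots,e_n^*$. For $p\in A$ let $\sigma_p$ be the automorphism of the $K$-algebra $L$ with $\sigma_p(e_2)=e_2+e_1p$, $\sigma_p(e_1^*)=e_1^*-pe_2^*$, and $\sigma_p(q)=q$ for all $q\in A$. Let $C_s(R_n)$ be the set of simple closed paths $e_{k_1}\cdots e_{k_m}$ with $k_m=2$ and $k_i\ne 2$ for $i<m$. For $d\in C_s(R_n)$, $f\in\mathrm{Irr}(K[x])$ and $p\in A$, let $S^{f,p}_d$ be the twisted module $(S^f_d)^{\sigma_p}$, that is, the additive group $S^f_d$ with the action $r*y=\sigma_p(r)y$. Write $p\equiv_{f,d}q$ if $p-q=rf(d)$ for some $r\in L$; this is an equivalence relation on $A$, and $[p]$ denotes the class of $p$. Then the set of left $L$-modules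 $$\{V_{[\alpha]}\mid \alpha \text{ an irrational infinite path}\}\ \sqcup\ \{S^f_{\Pi_c}\mid c \text{ a simple closed path},\ f\in\mathrm{Irr}(K[x])\}\ \sqcup\ \{S^{f,p}_d\mid d\in C_s(R_n),\ f\in\mathrm{Irr}(K[x]),\ [0]\ne[p]\in A/{\equiv_{f,d}}\}$$ consists of pairwise non-isomorphic simple modules. In detail, every module in it is simple, modules from different families are not isomorphic, and: - for irrational $\alpha,\beta$: $V_{[\alpha]}\cong V_{[\beta]}$ if and only if $\alpha\sim\beta$; - for simple closed paths $c,d$ and $f,g\in\mathrm{Irr}(K[x])$: $S^f_c\cong S^g_d$ if and only if $f=g$ and $d\in\Pi_c$; - for $c,d\in C_s(R_n)$, $f,g\in\mathrm{Irr}(K[x])$ and $p,q\in A$ with $p\not\equiv_{f,c}0$ and $q\not\equiv_{g,d}0$: $S^{f,p}_c\cong S^{g,q}_d$ if and only if $f=g$, $c=d$ and $p\equiv_{f,c}q$. -/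

import Mathlib

open scoped Polynomial

noncomputable section

namespace Rose

/-! ## The Leavitt path algebra of the rose with `n` petals

The petals `e_1, …, e_n` are indexed by `Fin n`, so `e_1` has index `0` and `e_2` has index `1`.
The rose has a single vertex `v`, and `v` is the identity of its Leavitt path algebra. -/

/-- The defining relations `e_i^* e_j = δ_{ij} v` and `∑ e_i e_i^* = v`, with `v = 1`.
`Sum.inl i` stands for `e_i` and `Sum.inr i` for `e_i^*`. -/
inductive LeavittRel (K : Type*) [Field K] (n : ℕ) :
    FreeAlgebra K (Fin n ⊕ Fin n) → FreeAlgebra K (Fin n ⊕ Fin n) → Prop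
  | ghost_mul_edge (i j : Fin n) :
      LeavittRel K n (FreeAlgebra.ι K (Sum.inr i) * FreeAlgebra.ι K (Sum.inl j))
        (if i = j then 1 else 0)
  | sum_edge_mul_ghost :
      LeavittRel K n (∑ i, FreeAlgebra.ι K (Sum.inl i) * FreeAlgebra.ι K (Sum.inr i)) 1

/-- The Leavitt path algebra `L_K(R_n)`. -/
def LPA (K : Type*) [Field K] (n : ℕ) : Type _ := RingQuot (LeavittRel K n)

instance (K : Type*) [Field K] (n : ℕ) : Ring (LPA K n) :=
  inferInstanceAs (Ring (RingQuot (LeavittRel K n)))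

instance (K : Type*) [Field K] (n : ℕ) : Algebra K (LPA K n) :=
  inferInstanceAs (Algebra K (RingQuot (LeavittRel K n)))

section LPA

variable (K : Type*) [Field K] {n : ℕ}

/-- The edge `e_i` in `L_K(R_n)`. -/
def edge (i : Fin n) : LPA K n :=
  RingQuot.mkAlgHom K (LeavittRel K n) (FreeAlgebra.ι K (Sum.inl i))

/-- The ghost edge `e_i^*` in `L_K(R_n)`. -/
def ghost (i : Fin n) : LPA K n :=
  RingQuot.mkAlgHom K (LeavittRel K n) (FreeAlgebra.ι K (Sum.inr i))

theorem ghost_mul_edge (i j : Fin n) :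
    ghost K i * edge K j = if i = j then 1 else 0 := by
  have h := RingQuot.mkAlgHom_rel K (LeavittRel.ghost_mul_edge (K := K) i j)
  rw [map_mul] at h
  refine h.trans ?_
  split_ifs
  · exact map_one _
  · exact map_zero _

theorem sum_edge_mul_ghost : ∑ i : Fin n, edge K i * ghost K i = 1 := by
  have h := RingQuot.mkAlgHom_rel K (LeavittRel.sum_edge_mul_ghost (K := K) (n := n))
  rw [map_sum, map_one] at h
  refine Eq.trans (Finset.sum_congr rfl fun i _ => ?_) h
  exact (map_mul _ _ _).symm

/-- The universal property of `L_K(R_n)`. -/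
def lift {B : Type*} [Ring B] [Algebra K B] (x y : Fin n → B)
    (h₁ : ∀ i j, y i * x j = if i = j then 1 else 0) (h₂ : ∑ i, x i * y i = 1) :
    LPA K n →ₐ[K] B :=
  RingQuot.liftAlgHom K ⟨FreeAlgebra.lift K (Sum.elim x y), by
    intro a b hab
    cases hab with
    | ghost_mul_edge i j =>
      have h := h₁ i j
      split_ifs at h ⊢ <;> simpa using h
    | sum_edge_mul_ghost => simpa using h₂⟩

section lift

variable {B : Type*} [Ring B] [Algebra K B] (x y : Fin n → B)
  (h₁ : ∀ i j, y i * x j = if i = j then 1 else 0) (h₂ : ∑ i, x i * y i = 1)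

theorem lift_edge (i : Fin n) : lift K x y h₁ h₂ (edge K i) = x i := by
  unfold lift edge
  exact (RingQuot.liftAlgHom_mkAlgHom_apply K _ _ _).trans (by simp)

theorem lift_ghost (i : Fin n) : lift K x y h₁ h₂ (ghost K i) = y i := by
  unfold lift ghost
  exact (RingQuot.liftAlgHom_mkAlgHom_apply K _ _ _).trans (by simp)

end lift

theorem algHom_ext {B : Type*} [Ring B] [Algebra K B] {φ ψ : LPA K n →ₐ[K] B}
    (h₁ : ∀ i, φ (edge K i) = ψ (edge K i)) (h₂ : ∀ i, φ (ghost K i) = ψ (ghost K i)) :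
    φ = ψ := by
  refine RingQuot.ringQuot_ext' K φ ψ ?_
  refine FreeAlgebra.hom_ext (funext fun s => ?_)
  cases s with
  | inl i => exact h₁ i
  | inr i => exact h₂ i

end LPA

/-! ## Paths

Since the rose has one vertex, every word in the petals is a path, and every nonempty word is a
closed path. -/

/-- A finite path `e_{k_1} ⋯ e_{k_m}`, as an element of `L_K(R_n)`. -/
def pathElt (K : Type*) [Field K] {n : ℕ} (c : List (Fin n)) : LPA K n :=
  (c.map (edge K)).prod

/-- `c` is a simple closed path: a path of positive length that is not a power `d ^ m`, `m ≥ 2`,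
of a closed path `d`. -/
def IsSCP {n : ℕ} (c : List (Fin n)) : Prop :=
  c ≠ [] ∧ ∀ (d : List (Fin n)) (m : ℕ), d ≠ [] → 2 ≤ m → c ≠ (List.replicate m d).flatten

/-- An infinite path `e_{k_1} e_{k_2} ⋯`. -/
abbrev InfPath (n : ℕ) : Type := ℕ → Fin n

/-- Tail-equivalence of infinite paths. -/
def TailEquiv {n : ℕ} (p q : InfPath n) : Prop :=
  ∃ a b : ℕ, ∀ i, p (i + a) = q (i + b)

/-- The infinite path `c c c ⋯`. -/
def powInf {n : ℕ} (c : List (Fin n)) (hc : c ≠ []) : InfPath n :=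
  fun i => c.get ⟨i % c.length, Nat.mod_lt _ (List.length_pos_of_ne_nil hc)⟩

/-- An infinite path is rational if it is tail-equivalent to `c c c ⋯` for a closed path `c`. -/
def IsRational {n : ℕ} (p : InfPath n) : Prop :=
  ∃ (c : List (Fin n)) (hc : c ≠ []), TailEquiv p (powInf c hc)

/-- The infinite path `e_i q`. -/
def InfPath.cons {n : ℕ} (i : Fin n) (q : InfPath n) : InfPath n
  | 0 => i
  | k + 1 => q k

/-- The infinite path `q` without its first edge. -/
def InfPath.tail {n : ℕ} (q : InfPath n) : InfPath n := fun k => q (k + 1)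

theorem TailEquiv.cons {n : ℕ} {p q : InfPath n} (i : Fin n) (h : TailEquiv q p) :
    TailEquiv (InfPath.cons i q) p := by
  obtain ⟨a, b, h⟩ := h
  exact ⟨a + 1, b, h⟩

theorem TailEquiv.tail {n : ℕ} {p q : InfPath n} (h : TailEquiv q p) :
    TailEquiv q.tail p := by
  obtain ⟨a, b, h⟩ := h
  refine ⟨a, b + 1, fun i => ?_⟩
  have := h (i + 1)
  simp only [InfPath.tail]
  rw [show i + a + 1 = i + 1 + a by ring, this]
  congr 1
  ring

/-! ## Chen's modules -/

/-- The underlying `K`-vector space of `V_[α]`: it has the tail-equivalence class of `α` as a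
basis. -/
def Chen (K : Type*) [Field K] {n : ℕ} (α : InfPath n) : Type _ :=
  {q : InfPath n // TailEquiv q α} →₀ K

section Chen

variable (K : Type*) [Field K] {n : ℕ} (α : InfPath n)

instance : AddCommGroup (Chen K α) :=
  inferInstanceAs (AddCommGroup ({q : InfPath n // TailEquiv q α} →₀ K))

instance : Module K (Chen K α) :=
  inferInstanceAs (Module K ({q : InfPath n // TailEquiv q α} →₀ K))

/-- The basis element of `V_[α]` given by an infinite path `q ∈ [α]`. -/
def Chen.of (q : {q : InfPath n // TailEquiv q α}) : Chen K α := Finsupp.single q 1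

/-- `q ↦ e_i q`. -/
def chenEdge (i : Fin n) : Module.End K (Chen K α) :=
  Finsupp.linearCombination K fun q : {q : InfPath n // TailEquiv q α} =>
    Chen.of K α ⟨InfPath.cons i q.1, q.2.cons i⟩

/-- `q ↦ q'` if `q = e_i q'`, and `q ↦ 0` if `q` does not start with `e_i`. -/
def chenGhost (i : Fin n) : Module.End K (Chen K α) :=
  Finsupp.linearCombination K fun q : {q : InfPath n // TailEquiv q α} =>
    if q.1 0 = i then Chen.of K α ⟨q.1.tail, q.2.tail⟩ else 0

theorem chenEdge_of (i : Fin n) (q : {q : InfPath n // TailEquiv q α}) :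
    chenEdge K α i (Chen.of K α q) = Chen.of K α ⟨InfPath.cons i q.1, q.2.cons i⟩ :=
  (Finsupp.linearCombination_single _ _ _).trans (one_smul _ _)

theorem chenGhost_of (i : Fin n) (q : {q : InfPath n // TailEquiv q α}) :
    chenGhost K α i (Chen.of K α q) =
      if q.1 0 = i then Chen.of K α ⟨q.1.tail, q.2.tail⟩ else 0 :=
  (Finsupp.linearCombination_single _ _ _).trans (one_smul _ _)

theorem chen_ext {φ ψ : Module.End K (Chen K α)}
    (h : ∀ q, φ (Chen.of K α q) = ψ (Chen.of K α q)) : φ = ψ :=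
  Finsupp.lhom_ext' fun q => LinearMap.ext_ring (h q)

/-- The action of `L_K(R_n)` on `V_[α]`. -/
def chenRep : LPA K n →ₐ[K] Module.End K (Chen K α) :=
  lift K (chenEdge K α) (chenGhost K α)
    (by
      intro i j
      refine chen_ext K α fun q => ?_
      rw [Module.End.mul_apply, chenEdge_of, chenGhost_of]
      by_cases h : i = j
      · subst h
        rw [if_pos rfl]
        exact if_pos rfl
      · simp [InfPath.cons, h, Ne.symm h])
    (by
      refine chen_ext K α fun q => ?_
      rw [LinearMap.sum_apply, Finset.sum_eq_single (q.1 0)]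
      · rw [Module.End.mul_apply, chenGhost_of, if_pos rfl, chenEdge_of, Module.End.one_apply]
        congr 1
        refine Subtype.ext (funext fun k => ?_)
        cases k <;> rfl
      · intro i _ hi
        rw [Module.End.mul_apply, chenGhost_of, if_neg (Ne.symm hi), map_zero]
      · intro h
        exact absurd (Finset.mem_univ _) h)

/-- Chen's left `L_K(R_n)`-module `V_[α]`. -/
instance : Module (LPA K n) (Chen K α) :=
  Module.compHom (Chen K α) (chenRep K α).toRingHom

end Chen

/-! ## The modules `S^f_c` -/

/-- The set `Irr(K[x])` of irreducible polynomials of the form `1 - a_1 x - ⋯ - a_n x ^ n`. -/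
def IsIrr {K : Type*} [Field K] (f : K[X]) : Prop :=
  Irreducible f ∧ f.coeff 0 = 1

/-- The left `L_K(R_n)`-module `S^f_c`, generated by one element `z` subject to `f(c) z = 0`. -/
abbrev SModule {K : Type*} [Field K] {n : ℕ} (f : K[X]) (c : List (Fin n)) : Type _ :=
  LPA K n ⧸ Submodule.span (LPA K n) {Polynomial.aeval (pathElt K c) f}

/-! ## Anick type automorphisms and twisted modules -/

/-- The index of `e_1`. -/
def i₁ {n : ℕ} (hn : 2 ≤ n) : Fin n := ⟨0, by omega⟩

/-- The index of `e_2`. -/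
def i₂ {n : ℕ} (hn : 2 ≤ n) : Fin n := ⟨1, by omega⟩

theorem i₁_ne_i₂ {n : ℕ} (hn : 2 ≤ n) : i₁ hn ≠ i₂ hn := by
  simp [i₁, i₂]

/-- The `K`-subalgebra `A_{R_n}(e_1, e_2)` of `L_K(R_n)` generated by
`v, e_1, e_3, …, e_n, e_2^*, …, e_n^*`. -/
def anickSubalgebra (K : Type*) [Field K] {n : ℕ} (hn : 2 ≤ n) : Subalgebra K (LPA K n) :=
  Algebra.adjoin K
    (edge K '' {i | i ≠ i₂ hn} ∪ ghost K '' {i | i ≠ i₁ hn})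

section Anick

variable {K : Type*} [Field K] {n : ℕ} (hn : 2 ≤ n)

/-- The endomorphism of `L_K(R_n)` with `e_2 ↦ e_2 + e_1 p` and `e_1^* ↦ e_1^* - p e_2^*` that
fixes the other `e_i` and `e_i^*`. -/
def anickHom (p : LPA K n) : LPA K n →ₐ[K] LPA K n :=
  lift K
    (fun i => if i = i₂ hn then edge K (i₂ hn) + edge K (i₁ hn) * p else edge K i)
    (fun i => if i = i₁ hn then ghost K (i₁ hn) - p * ghost K (i₂ hn) else ghost K i)
    (by
      have h12 := i₁_ne_i₂ hn
      intro i j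
      by_cases hi : i = i₁ hn <;> by_cases hj : j = i₂ hn
      · subst hi hj
        simp [mul_add, sub_mul, ← mul_assoc, ghost_mul_edge, mul_assoc p, h12, h12.symm]
      · subst hi
        simp [hj, sub_mul, mul_assoc, ghost_mul_edge, Ne.symm hj]
      · subst hj
        simp [hi, mul_add, ← mul_assoc, ghost_mul_edge]
      · simp [hi, hj, ghost_mul_edge])
    (by
      have h12 := i₁_ne_i₂ hn
      rw [← sum_edge_mul_ghost K (n := n)]
      rw [← Finset.add_sum_erase _ _ (Finset.mem_univ (i₁ hn)),
        ← Finset.add_sum_erase _ (fun i => edge K i * ghost K i) (Finset.mem_univ (i₁ hn)),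
        ← Finset.add_sum_erase _ _ (Finset.mem_erase.2 ⟨h12.symm, Finset.mem_univ (i₂ hn)⟩),
        ← Finset.add_sum_erase _ (fun i => edge K i * ghost K i)
          (Finset.mem_erase.2 ⟨h12.symm, Finset.mem_univ (i₂ hn)⟩)]
      rw [← add_assoc, ← add_assoc]
      congr 1
      · simp [h12, h12.symm, mul_sub, add_mul, mul_assoc]
      · refine Finset.sum_congr rfl fun i hi => ?_
        simp only [Finset.mem_erase, Finset.mem_univ, and_true] at hi
        simp [hi.1, hi.2])

theorem anickHom_edge (p : LPA K n) (i : Fin n) :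
    anickHom hn p (edge K i) =
      if i = i₂ hn then edge K (i₂ hn) + edge K (i₁ hn) * p else edge K i :=
  lift_edge ..

theorem anickHom_ghost (p : LPA K n) (i : Fin n) :
    anickHom hn p (ghost K i) =
      if i = i₁ hn then ghost K (i₁ hn) - p * ghost K (i₂ hn) else ghost K i :=
  lift_ghost ..

theorem anickHom_fix (p : LPA K n) {q : LPA K n} (hq : q ∈ anickSubalgebra K hn) :
    anickHom hn p q = q := by
  have h : anickSubalgebra K hn ≤ AlgHom.equalizer (anickHom hn p) (AlgHom.id K _) := by
    refine Algebra.adjoin_le ?_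
    rintro _ (⟨i, hi, rfl⟩ | ⟨i, hi, rfl⟩)
    · exact (anickHom_edge hn p i).trans (if_neg hi)
    · exact (anickHom_ghost hn p i).trans (if_neg hi)
  exact h hq

theorem anickHom_comp_neg {p : LPA K n} (hp : p ∈ anickSubalgebra K hn) :
    (anickHom hn p).comp (anickHom hn (-p)) = AlgHom.id K (LPA K n) := by
  have h12 := i₁_ne_i₂ hn
  refine algHom_ext K (fun i => ?_) (fun i => ?_)
  · rw [AlgHom.comp_apply, anickHom_edge]
    split_ifs with h
    · subst h
      simp [anickHom_edge, anickHom_fix hn p hp, h12]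
    · simp [anickHom_edge, h]
  · rw [AlgHom.comp_apply, anickHom_ghost]
    split_ifs with h
    · subst h
      simp [anickHom_ghost, anickHom_fix hn p hp, h12.symm]
    · simp [anickHom_ghost, h]

/-- The Anick type automorphism `σ_p` of `L_K(R_n)`, for `p ∈ A_{R_n}(e_1, e_2)`; its inverse
is `σ_{-p}`. -/
def anick (p : anickSubalgebra K hn) : LPA K n ≃ₐ[K] LPA K n :=
  AlgEquiv.ofAlgHom (anickHom hn (p : LPA K n)) (anickHom hn (-(p : LPA K n)))
    (anickHom_comp_neg hn p.2)
    (by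
      have h := anickHom_comp_neg hn (neg_mem p.2)
      rwa [neg_neg] at h)

/-- `C_s(R_n)`: the simple closed paths `e_{k_1} ⋯ e_{k_m}` with `k_m = 2` and
`k_i ∈ {1, 3, …, n}` for `i < m`. -/
def IsCs (c : List (Fin n)) : Prop :=
  IsSCP c ∧ ∃ l : List (Fin n), c = l ++ [i₂ hn] ∧ ∀ k ∈ l, k ≠ i₂ hn

end Anick

/-- The twisted module `M^σ`: the additive group `M` with the action `r ∗ m = σ(r) m`. -/
def Twist {A M : Type*} [Ring A] (_σ : A →+* A) [AddCommGroup M] [Module A M] : Type _ := M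

section Twist

variable {A M : Type*} [Ring A] (σ : A →+* A) [AddCommGroup M] [Module A M]

instance : AddCommGroup (Twist (M := M) σ) := inferInstanceAs (AddCommGroup M)

instance : Module A (Twist (M := M) σ) := Module.compHom M σ

end Twist

/-- The twisted module `S^{f,p}_c = (S^f_c)^{σ_p}`. -/
abbrev TwistedS {K : Type*} [Field K] {n : ℕ} (hn : 2 ≤ n) (f : K[X]) (c : List (Fin n))
    (p : anickSubalgebra K hn) : Type _ :=
  Twist (M := SModule f c) (anick hn p : LPA K n →+* LPA K n)

/-- The equivalence relation `p ≡_{f,c} q` on `A_{R_n}(e_1, e_2)`. -/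
def AnickEquiv {K : Type*} [Field K] {n : ℕ} (hn : 2 ≤ n) (f : K[X]) (c : List (Fin n))
    (p q : anickSubalgebra K hn) : Prop :=
  ∃ r : LPA K n, (p : LPA K n) - (q : LPA K n) = r * Polynomial.aeval (pathElt K c) f

end Rose

end

open Rose

/-! For an infinite path `q`, write `q_N` for its initial part of length `N`. The invariant is the
support of a module element `y`: the infinite paths `q` such that no ghost path `q_N^*` annihilates
`y`. Isomorphisms preserve it, and since `1 = ∑ e_i e_i^*` a nonzero element has nonempty support
(`supp_nonempty`).

The modules `V_[α]` and `S^f_c` are both generated by an element `z` with `q_N q_N^* z = z` for all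
`N`, where `q` is `α` or `c^∞`. In such a module every support is finite and consists of paths
tail-equivalent to `q` (`finite_supp`, `tailEquiv_of_mem_supp`). A long enough ghost path along a
support point moves any nonzero element into a span of elements `q_b^* z`, and a path brings it back
to a nonzero element of the span of the `q_a q_b^* z` with equal tails after `a` and `b` edges.
Simplicity therefore only has to be checked on that span (`Conc.isSimpleModule`). It is the line `K
z` for irrational `α`. For a simple closed path `c` it lies in `K[c] z`, where Bézout's identity
with the irreducible `f` recovers `z`. That `z ≠ 0` in `S^f_c` is seen in a Chen module over the
algebraic closure, with rescaled edges (`one_ne_mul_aeval`).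

Tails separate the Chen modules from each other and from the `S^f_c`, and determine `c` up to
rotation; comparing annihilating polynomials then determines `f`. For the twisted modules, if `p z ≠
0` then the generator of `S^{f,p}_d` has infinite support (`infinite_supp_twist_gen`), which cannot
occur in the first two families; if `p z = 0` the twist changes nothing up to isomorphism. Comparing
twists by `p` and `q` reduces to one twist by `p - q`, because `σ_p = σ_{p-q} σ_q`. -/

namespace Rose

/-! ### Tails of infinite paths -/

section Paths

variable {n : ℕ}

/-- The infinite path `q` without its first `N` edges. -/
def shift (q : InfPath n) (N : ℕ) : InfPath n := fun i => q (i + N)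

theorem shift_shift (q : InfPath n) (a b : ℕ) : shift (shift q a) b = shift q (a + b) := by
  funext i
  simp only [shift]
  congr 1
  omega

theorem cons_tail (q : InfPath n) : InfPath.cons (q 0) q.tail = q := by
  funext k
  cases k <;> rfl

theorem TailEquiv.refl (q : InfPath n) : TailEquiv q q := ⟨0, 0, fun _ => rfl⟩

theorem TailEquiv.symm {p q : InfPath n} (h : TailEquiv p q) : TailEquiv q p := by
  obtain ⟨a, b, h⟩ := h
  exact ⟨b, a, fun i => (h i).symm⟩

theorem TailEquiv.trans {p q r : InfPath n} (h : TailEquiv p q) (h' : TailEquiv q r) :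
    TailEquiv p r := by
  obtain ⟨a, b, h⟩ := h
  obtain ⟨a', b', h'⟩ := h'
  refine ⟨a' + a, b + b', fun i => ?_⟩
  rw [← add_assoc, h, show i + a' + b = i + b + a' by ring, h', add_assoc]

theorem tailEquiv_of_shift_eq {p q : InfPath n} {a b : ℕ} (h : shift p a = shift q b) :
    TailEquiv p q :=
  ⟨a, b, fun i => congrFun h i⟩

theorem shift_tailEquiv (q : InfPath n) (N : ℕ) : TailEquiv (shift q N) q :=
  ⟨0, N, fun _ => rfl⟩

/-- Two equal tails at different positions make the earlier one periodic, so the path ends in a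
power of one period. -/
theorem shift_injective_of_not_isRational {q : InfPath n} (hq : ¬ IsRational q) {a b : ℕ}
    (h : shift q a = shift q b) : a = b := by
  wlog hab : a < b generalizing a b
  · rcases eq_or_ne a b with h' | h'
    · exact h'
    · exact (this h.symm (by omega)).symm
  exfalso
  obtain ⟨t, rfl⟩ := Nat.exists_eq_add_of_lt hab
  set r := shift q a with hr
  have hper : ∀ k i, r (i + (t + 1) * k) = r i := by
    intro k
    induction k with
    | zero => simp
    | succ k ih =>
      intro i
      have := congrFun h (i + (t + 1) * k)
      rw [ih] at this
      rw [this]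
      simp only [hr, shift]
      congr 1
      ring
  have hne : (List.range (t + 1)).map r ≠ [] := by simp
  refine hq ⟨(List.range (t + 1)).map r, hne, a, 0, fun i => ?_⟩
  simp only [powInf, List.get_eq_getElem, List.getElem_map, List.getElem_range, List.length_map,
    List.length_range, add_zero]
  change r i = _
  conv_lhs => rw [← Nat.mod_add_div i (t + 1)]
  exact hper _ _

end Paths

/-! ### Initial paths and their ghosts in the Leavitt path algebra -/

section Prefix

variable (K : Type*) [Field K] {n : ℕ}

/-- The initial part of length `N` of the infinite path `q`, as an element of `L_K(R_n)`. -/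
noncomputable def ed (q : InfPath n) : ℕ → LPA K n
  | 0 => 1
  | N + 1 => ed q N * edge K (q N)

/-- The ghost path of the initial part of length `N` of the infinite path `q`. -/
noncomputable def gh (q : InfPath n) : ℕ → LPA K n
  | 0 => 1
  | N + 1 => ghost K (q N) * gh q N

theorem ed_add (q : InfPath n) (a b : ℕ) : ed K q (a + b) = ed K q a * ed K (shift q a) b := by
  induction b with
  | zero => simp [ed]
  | succ b ih => rw [← add_assoc, ed, ih, ed, mul_assoc, shift, add_comm b a]

theorem gh_add (q : InfPath n) (a b : ℕ) : gh K q (a + b) = gh K (shift q a) b * gh K q a := by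
  induction b with
  | zero => simp [gh]
  | succ b ih => rw [← add_assoc, gh, ih, gh, mul_assoc, shift, add_comm b a]

theorem ghost_mul_edge_self (i : Fin n) : ghost K i * edge K i = 1 := by
  simp [ghost_mul_edge]

theorem ghost_mul_edge_of_ne {i j : Fin n} (h : i ≠ j) : ghost K i * edge K j = 0 := by
  simp [ghost_mul_edge, h]

theorem gh_mul_ed (q : InfPath n) (N : ℕ) : gh K q N * ed K q N = 1 := by
  induction N with
  | zero => simp [gh, ed]
  | succ N ih =>
    rw [gh, ed, mul_assoc, ← mul_assoc (gh K q N), ih, one_mul, ghost_mul_edge_self]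

theorem gh_cons (i : Fin n) (q : InfPath n) (N : ℕ) :
    gh K (InfPath.cons i q) (N + 1) = gh K q N * ghost K i := by
  rw [add_comm, gh_add]
  simp only [gh, mul_one]
  rfl

theorem gh_succ' (q : InfPath n) (N : ℕ) :
    gh K q (N + 1) = gh K q.tail N * ghost K (q 0) := by
  conv_lhs => rw [← cons_tail q]
  exact gh_cons K _ _ _

/-- Up to the first disagreement the product telescopes to `1`; there the relation `e_i^* e_j = 0`
kills it. -/
theorem exists_gh_mul_ed_eq_zero {q r : InfPath n} (h : r ≠ q) :
    ∃ N, gh K r N * ed K q N = 0 := by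
  classical
  have hex : ∃ k, r k ≠ q k := Function.ne_iff.1 h
  have hmin : ∀ N ≤ Nat.find hex, gh K r N * ed K q N = 1 := by
    intro N
    induction N with
    | zero => simp [gh, ed]
    | succ N ih =>
      intro hN
      have : r N = q N := by simpa using Nat.find_min hex (m := N) (by omega)
      rw [gh, ed, mul_assoc, ← mul_assoc (gh K r N), ih (by omega), one_mul, this,
        ghost_mul_edge_self]
  refine ⟨Nat.find hex + 1, ?_⟩
  rw [gh, ed, mul_assoc, ← mul_assoc (gh K r _), hmin _ le_rfl, one_mul,
    ghost_mul_edge_of_ne K (Nat.find_spec hex)]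

theorem ed_eq_pathElt (q : InfPath n) (N : ℕ) :
    ed K q N = pathElt K ((List.range N).map q) := by
  induction N with
  | zero => simp [ed, pathElt]
  | succ N ih => rw [ed, ih]; simp [pathElt, List.range_succ]

theorem pathElt_append (c d : List (Fin n)) :
    pathElt K (c ++ d) = pathElt K c * pathElt K d := by
  simp [pathElt]

variable {K}

theorem LPA_induction {P : LPA K n → Prop} (hK : ∀ k, P (algebraMap K _ k))
    (hE : ∀ i, P (edge K i)) (hG : ∀ i, P (ghost K i))
    (hadd : ∀ a b, P a → P b → P (a + b)) (hmul : ∀ a b, P a → P b → P (a * b)) (r : LPA K n) :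
    P r := by
  obtain ⟨x, rfl⟩ := RingQuot.mkAlgHom_surjective K (LeavittRel K n) r
  induction x using FreeAlgebra.induction with
  | grade0 k =>
    have : RingQuot.mkAlgHom K (LeavittRel K n) (algebraMap K _ k) = algebraMap K (LPA K n) k :=
      AlgHom.commutes (RingQuot.mkAlgHom K (LeavittRel K n)) k
    rw [this]
    exact hK k
  | grade1 s => cases s with
    | inl i => exact hE i
    | inr i => exact hG i
  | mul a b ha hb =>
    have := map_mul (RingQuot.mkAlgHom K (LeavittRel K n)) a b
    rw [this]
    exact hmul _ _ ha hb
  | add a b ha hb =>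
    have := map_add (RingQuot.mkAlgHom K (LeavittRel K n)) a b
    rw [this]
    exact hadd _ _ ha hb

end Prefix

/-! ### Supports, concentrated generators and the simplicity criterion -/

section Support

variable {K : Type*} [Field K] {n : ℕ} {M : Type*} [AddCommGroup M] [Module (LPA K n) M]

/-- The support of a module element `y`: the infinite paths none of whose initial ghost paths
annihilate `y`. -/
def supp (K : Type*) [Field K] {n : ℕ} {M : Type*} [AddCommGroup M] [Module (LPA K n) M] (y : M) :
    Set (InfPath n) :=
  {q | ∀ N, gh K q N • y ≠ 0}

theorem gh_smul_eq_zero_of_le {q : InfPath n} {y : M} {a b : ℕ} (hab : a ≤ b)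
    (h : gh K q a • y = 0) : gh K q b • y = 0 := by
  obtain ⟨t, rfl⟩ := Nat.exists_eq_add_of_le hab
  rw [gh_add, mul_smul, h, smul_zero]

theorem eq_sum_edge_smul_ghost_smul (y : M) : y = ∑ i : Fin n, edge K i • ghost K i • y := by
  simp_rw [← mul_smul]
  rw [← Finset.sum_smul, sum_edge_mul_ghost, one_smul]

theorem exists_ghost_smul_ne_zero {y : M} (hy : y ≠ 0) : ∃ i : Fin n, ghost K i • y ≠ 0 := by
  by_contra! h
  apply hy
  rw [eq_sum_edge_smul_ghost_smul (K := K) (n := n) y]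
  simp [h]

/-- Some `e_i^*` does not kill a given nonzero element; iterating this choice spells out an infinite
path in the support. -/
theorem supp_nonempty {y : M} (hy : y ≠ 0) : (supp K (n := n) y).Nonempty := by
  choose i hi using fun y : {y : M // y ≠ 0} => exists_ghost_smul_ne_zero (K := K) (n := n) y.2
  let s : ℕ → {y : M // y ≠ 0} := fun N =>
    Nat.rec ⟨y, hy⟩ (fun _ x => ⟨ghost K (i x) • x.1, hi x⟩) N
  have hs : ∀ N, gh K (fun k => i (s k)) N • y = (s N).1 := by
    intro N
    induction N with
    | zero => simp [gh, s]
    | succ N ih => rw [gh, mul_smul, ih]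
  exact ⟨fun k => i (s k), fun N => by rw [hs]; exact (s N).2⟩

theorem supp_equiv {M' : Type*} [AddCommGroup M'] [Module (LPA K n) M'] (e : M ≃ₗ[LPA K n] M')
    (y : M) : supp K (n := n) (e y) = supp K y := by
  ext q
  simp [supp, ← map_smul]

theorem cons_mem_supp {i : Fin n} {q : InfPath n} {y : M} (h : q ∈ supp K (ghost K i • y)) :
    InfPath.cons i q ∈ supp K y := by
  intro N hN
  refine h N ?_
  rw [← mul_smul, ← gh_cons]
  exact gh_smul_eq_zero_of_le (Nat.le_succ N) hN

theorem exists_mem_supp_of_gh (w : InfPath n) (N : ℕ) {q : InfPath n} {y : M}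
    (h : q ∈ supp K (gh K w N • y)) :
    ∃ r ∈ supp K y, (∀ i < N, r i = w i) ∧ ∀ i, r (N + i) = q i := by
  induction N generalizing q with
  | zero => exact ⟨q, by simpa [gh] using h, by simp, by simp⟩
  | succ N ih =>
    rw [gh, mul_smul] at h
    obtain ⟨r, hr, h1, h2⟩ := ih (cons_mem_supp h)
    refine ⟨r, hr, fun i hi => ?_, fun i => ?_⟩
    · rcases Nat.lt_succ_iff_lt_or_eq.1 hi with h | rfl
      · exact h1 i h
      · exact h2 0
    · rw [add_assoc, add_comm 1 i, h2]
      rfl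

theorem supp_add_subset (x y : M) : supp K (n := n) (x + y) ⊆ supp K x ∪ supp K y := by
  intro q hq
  by_contra h
  simp only [supp, Set.mem_union, Set.mem_ofPred_eq, not_or, not_forall, not_not] at h
  obtain ⟨⟨a, ha⟩, b, hb⟩ := h
  refine hq (a + b) ?_
  rw [smul_add, gh_smul_eq_zero_of_le (Nat.le_add_right a b) ha,
    gh_smul_eq_zero_of_le (Nat.le_add_left b a) hb, add_zero]

theorem supp_zero : supp K (n := n) (0 : M) = ∅ := by
  ext q
  simp [supp]

theorem supp_edge_subset (i : Fin n) (y : M) :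
    supp K (edge K i • y) ⊆ InfPath.cons i '' supp K y := by
  intro q hq
  by_cases h : q 0 = i
  · refine ⟨q.tail, fun N hN => hq (N + 1) ?_, h ▸ cons_tail q⟩
    rw [gh_succ', h, mul_smul, ← mul_smul (ghost K i), ghost_mul_edge_self, one_smul, hN]
  · refine absurd ?_ (hq 1)
    rw [gh_succ', mul_smul, ← mul_smul (ghost K _), ghost_mul_edge_of_ne K h, zero_smul, smul_zero]

/-- The element `z` is concentrated at the infinite path `q`. -/
def Conc (K : Type*) [Field K] {n : ℕ} {M : Type*} [AddCommGroup M] [Module (LPA K n) M]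
    (q : InfPath n) (z : M) : Prop :=
  ∀ N, ed K q N • gh K q N • z = z

theorem Conc.map {M' : Type*} [AddCommGroup M'] [Module (LPA K n) M'] (φ : M →ₗ[LPA K n] M')
    {q : InfPath n} {z : M} (h : Conc K q z) : Conc K q (φ z) := fun N => by
  rw [← map_smul, ← map_smul, h]

theorem Conc.supp_subset {q : InfPath n} {z : M} (h : Conc K q z) : supp K z ⊆ {q} := by
  intro r hr
  by_contra hne
  obtain ⟨N, hN⟩ := exists_gh_mul_ed_eq_zero K (r := r) (q := q) hne
  refine hr N ?_
  rw [← h N, ← mul_smul, hN, zero_smul]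

theorem Conc.gh_smul_eq {q : InfPath n} {z : M} (h : Conc K q z) (a b : ℕ) :
    gh K q a • z = ed K (shift q a) b • gh K q (a + b) • z := by
  conv_lhs => rw [← h (a + b), ed_add, ← mul_smul, ← mul_assoc, gh_mul_ed, one_mul]

variable [Module K M]

/-- The span of the elements `q_b^* z`, where `q_b` is the initial part of `q` whose removal
yields `r`. -/
def tailSpan (K : Type*) [Field K] {n : ℕ} {M : Type*} [AddCommGroup M] [Module (LPA K n) M]
    [Module K M] (q : InfPath n) (z : M) (r : InfPath n) : Submodule K M :=
  Submodule.span K {y | ∃ b, shift q b = r ∧ y = gh K q b • z}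

theorem exists_shift_eq_of_tailSpan_ne_bot {q r : InfPath n} {z y : M}
    (hy : y ∈ tailSpan K q z r) (h0 : y ≠ 0) : ∃ b, shift q b = r := by
  by_contra! h
  apply h0
  have : {y | ∃ b, shift q b = r ∧ y = gh K q b • z} = ∅ := by
    ext y
    simp [h]
  simpa [tailSpan, this] using hy

variable [IsScalarTower K (LPA K n) M]

theorem smul_mem_of_stable (S : Submodule K M) (hE : ∀ i, ∀ y ∈ S, edge K (n := n) i • y ∈ S)
    (hG : ∀ i, ∀ y ∈ S, ghost K (n := n) i • y ∈ S) (r : LPA K n) : ∀ y ∈ S, r • y ∈ S := by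
  refine LPA_induction (P := fun r => ∀ y ∈ S, r • y ∈ S) ?_ hE hG ?_ ?_ r
  · intro k y hy
    rw [algebraMap_smul]
    exact S.smul_mem k hy
  · intro a b ha hb y hy
    rw [add_smul]
    exact S.add_mem (ha y hy) (hb y hy)
  · intro a b ha hb y hy
    rw [mul_smul]
    exact ha _ (hb y hy)

theorem supp_smul_subset (k : K) (y : M) : supp K (n := n) (k • y) ⊆ supp K y := by
  intro q hq N hN
  refine hq N ?_
  rw [smul_comm, hN, smul_zero]

/-- The elements with finite support. -/
def finSupp (K : Type*) [Field K] (n : ℕ) (M : Type*) [AddCommGroup M] [Module (LPA K n) M]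
    [Module K M] [IsScalarTower K (LPA K n) M] : Submodule K M where
  carrier := {y | (supp K (n := n) y).Finite}
  add_mem' hx hy := (hx.union hy).subset (supp_add_subset _ _)
  zero_mem' := by simp [supp_zero]
  smul_mem' k _ hy := hy.subset (supp_smul_subset k _)

/-- The elements of finite support are stable under edges (supports get prefixed) and ghosts
(prefixing is injective into the old support), and they include the generator, whose support is at
most `{q}`. -/
theorem finite_supp {q : InfPath n} {z : M} (h : Conc K q z)
    (hz : ∀ y : M, ∃ r : LPA K n, r • z = y) (y : M) : (supp K (n := n) y).Finite := by
  obtain ⟨r, rfl⟩ := hz y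
  refine smul_mem_of_stable (finSupp K n M) ?_ ?_ r z ((Set.finite_singleton q).subset h.supp_subset)
  · intro i y hy
    exact (Set.Finite.image _ hy).subset (supp_edge_subset i y)
  · intro i y hy
    have h1 : InfPath.cons i '' supp K (ghost K i • y) ⊆ supp K y := by
      rintro _ ⟨q, hq, rfl⟩
      exact cons_mem_supp hq
    refine Set.Finite.of_finite_image (hy.subset h1) (Function.Injective.injOn ?_)
    intro a b hab
    funext k
    exact congrFun hab (k + 1)

theorem gh_smul_mem_tailSpan {q r : InfPath n} {z y : M} (hy : y ∈ tailSpan K q z r) (t : ℕ) :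
    gh K r t • y ∈ tailSpan K q z (shift r t) := by
  induction hy using Submodule.span_induction with
  | mem y hy =>
    obtain ⟨b, rfl, rfl⟩ := hy
    refine Submodule.subset_span ⟨b + t, (shift_shift _ _ _).symm, ?_⟩
    rw [gh_add, mul_smul]
  | zero => simp
  | add x y _ _ hx hy => rw [smul_add]; exact add_mem hx hy
  | smul k y _ hy => rw [smul_comm]; exact Submodule.smul_mem _ k hy

theorem gh_add_smul_mem_tailSpan {q r : InfPath n} {z y : M} {N : ℕ}
    (hy : gh K r N • y ∈ tailSpan K q z (shift r N)) (t : ℕ) :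
    gh K r (N + t) • y ∈ tailSpan K q z (shift r (N + t)) := by
  rw [gh_add, mul_smul, ← shift_shift]
  exact gh_smul_mem_tailSpan hy t

/-- The property is a submodule condition only when it is asked for all `r` at once, since edges and
ghosts lengthen or shorten the path under test. For `z` itself, either `r = q` or some initial ghost
path of `r` kills `z`. -/
theorem exists_gh_smul_mem_tailSpan {q : InfPath n} {z : M} (h : Conc K q z)
    (hz : ∀ y : M, ∃ r : LPA K n, r • z = y) (y : M) (r : InfPath n) :
    ∃ N, gh K r N • y ∈ tailSpan K q z (shift r N) := by
  let S : Submodule K M :=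
    { carrier := {y | ∀ r, ∃ N, gh K r N • y ∈ tailSpan K q z (shift r N)}
      add_mem' := by
        intro x y hx hy r
        obtain ⟨a, ha⟩ := hx r
        obtain ⟨b, hb⟩ := hy r
        refine ⟨a + b, ?_⟩
        rw [smul_add]
        refine add_mem (gh_add_smul_mem_tailSpan ha b) ?_
        rw [add_comm a b]
        exact gh_add_smul_mem_tailSpan hb a
      zero_mem' := fun r => ⟨0, by simp⟩
      smul_mem' := by
        intro k y hy r
        obtain ⟨N, hN⟩ := hy r
        exact ⟨N, by rw [smul_comm]; exact Submodule.smul_mem _ k hN⟩ }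
  obtain ⟨s, rfl⟩ := hz y
  refine smul_mem_of_stable S ?_ ?_ s z ?_ r
  · intro i y hy r
    by_cases hi : r 0 = i
    · obtain ⟨N, hN⟩ := hy r.tail
      refine ⟨N + 1, ?_⟩
      rw [gh_succ', hi, mul_smul, ← mul_smul (ghost K i), ghost_mul_edge_self, one_smul,
        add_comm, ← shift_shift]
      exact hN
    · refine ⟨1, ?_⟩
      rw [gh_succ', mul_smul, ← mul_smul (ghost K _), ghost_mul_edge_of_ne K hi, zero_smul,
        smul_zero]
      exact zero_mem _
  · intro i y hy r
    obtain ⟨N, hN⟩ := hy (InfPath.cons i r)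
    refine ⟨N, ?_⟩
    have := gh_add_smul_mem_tailSpan hN 1
    rw [gh_cons, mul_smul, add_comm, ← shift_shift] at this
    exact this
  · intro r
    by_cases hr : r = q
    · subst hr
      exact ⟨0, Submodule.subset_span ⟨0, rfl, rfl⟩⟩
    · obtain ⟨N, hN⟩ := exists_gh_mul_ed_eq_zero K hr
      refine ⟨N, ?_⟩
      have h0 : gh K r N • z = 0 := by rw [← h N, ← mul_smul, hN, zero_smul]
      rw [h0]
      exact zero_mem _

theorem tailEquiv_of_mem_supp {q : InfPath n} {z : M} (h : Conc K q z)
    (hz : ∀ y : M, ∃ r : LPA K n, r • z = y) {y : M} {r : InfPath n} (hr : r ∈ supp K y) :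
    TailEquiv r q := by
  obtain ⟨N, hN⟩ := exists_gh_smul_mem_tailSpan h hz y r
  obtain ⟨b, hb⟩ := exists_shift_eq_of_tailSpan_ne_bot hN (hr N)
  exact tailEquiv_of_shift_eq hb.symm

/-- The span of the elements `q_a q_b^* z`, where `q_a` and `q_b` are initial parts of `q` whose
removal yields the same path. -/
def isotropySpan (K : Type*) [Field K] {n : ℕ} {M : Type*} [AddCommGroup M] [Module (LPA K n) M]
    [Module K M] (q : InfPath n) (z : M) : Submodule K M :=
  Submodule.span K {y | ∃ a b, shift q a = shift q b ∧ y = ed K q a • gh K q b • z}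

theorem ed_smul_mem_isotropySpan {q : InfPath n} {z y : M} {N : ℕ}
    (hy : y ∈ tailSpan K q z (shift q N)) : ed K q N • y ∈ isotropySpan K q z := by
  induction hy using Submodule.span_induction with
  | mem y hy =>
    obtain ⟨b, hb, rfl⟩ := hy
    exact Submodule.subset_span ⟨N, b, hb.symm, rfl⟩
  | zero => simp
  | add x y _ _ hx hy => rw [smul_add]; exact add_mem hx hy
  | smul k y _ hy => rw [smul_comm]; exact Submodule.smul_mem _ k hy

/-- Used to locate the image of a concentrated generator under an isomorphism. -/
theorem Conc.mem_isotropySpan {q : InfPath n} {z : M} (h : Conc K q z)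
    (hz : ∀ y : M, ∃ r : LPA K n, r • z = y) {y : M} (hy : Conc K q y) :
    y ∈ isotropySpan K q z := by
  obtain ⟨N, hN⟩ := exists_gh_smul_mem_tailSpan h hz y q
  rw [← hy N]
  exact ed_smul_mem_isotropySpan hN

theorem isSimpleModule_of_exists_smul {R N : Type*} [Ring R] [AddCommGroup N] [Module R N]
    {z : N} (hz0 : z ≠ 0) (hz : ∀ y : N, ∃ r : R, r • z = y)
    (h : ∀ y : N, y ≠ 0 → ∃ r : R, r • y = z) : IsSimpleModule R N := by
  rw [isSimpleModule_iff_toSpanSingleton_surjective]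
  refine ⟨⟨⟨z, 0, hz0⟩⟩, fun y hy x => ?_⟩
  obtain ⟨r, hr⟩ := h y hy
  obtain ⟨s, hs⟩ := hz x
  exact ⟨s * r, by simp [mul_smul, hr, hs]⟩

theorem Conc.isSimpleModule {q : InfPath n} {z : M} (h : Conc K q z) (hz0 : z ≠ 0)
    (hz : ∀ y : M, ∃ r : LPA K n, r • z = y)
    (hi : ∀ y ∈ isotropySpan K q z, y ≠ 0 → ∃ r : LPA K n, r • y = z) :
    IsSimpleModule (LPA K n) M := by
  refine isSimpleModule_of_exists_smul hz0 hz fun y hy => ?_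
  obtain ⟨r, hr⟩ := supp_nonempty (K := K) (n := n) hy
  obtain ⟨N, hN⟩ := exists_gh_smul_mem_tailSpan h hz y r
  obtain ⟨b, hb⟩ := exists_shift_eq_of_tailSpan_ne_bot hN (hr N)
  rw [← hb] at hN
  -- Returning along `q_b` loses nothing, because `q_b^* q_b = 1`.
  obtain ⟨s, hs⟩ := hi _ (ed_smul_mem_isotropySpan hN) (fun h0 => hr N (by
    have := congrArg (gh K q b • ·) h0
    simpa only [← mul_smul, gh_mul_ed, one_smul, ← mul_assoc, one_mul, smul_zero] using this))
  exact ⟨s * ed K q b * gh K r N, by simpa only [mul_smul] using hs⟩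

end Support

/-! ### Chen's modules -/

section ChenModule

variable (K : Type*) [Field K] {n : ℕ} (α : InfPath n)

theorem smul_chen (r : LPA K n) (y : Chen K α) : r • y = chenRep K α r y := rfl

theorem edge_smul_chen (i : Fin n) (y : Chen K α) : edge K i • y = chenEdge K α i y := by
  rw [smul_chen, chenRep, lift_edge]

theorem ghost_smul_chen (i : Fin n) (y : Chen K α) : ghost K i • y = chenGhost K α i y := by
  rw [smul_chen, chenRep, lift_ghost]

instance : IsScalarTower K (LPA K n) (Chen K α) where
  smul_assoc k r y := by
    rw [smul_chen, smul_chen, map_smul]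
    rfl

variable {α}

theorem edge_smul_of (i : Fin n) (q : {q : InfPath n // TailEquiv q α}) :
    edge K i • Chen.of K α q = Chen.of K α ⟨InfPath.cons i q.1, q.2.cons i⟩ := by
  rw [edge_smul_chen, chenEdge_of]

theorem ghost_smul_of (i : Fin n) (q : {q : InfPath n // TailEquiv q α}) :
    ghost K i • Chen.of K α q = if q.1 0 = i then Chen.of K α ⟨q.1.tail, q.2.tail⟩ else 0 := by
  rw [ghost_smul_chen, chenGhost_of]

theorem ed_smul_of (q : InfPath n) (N : ℕ) (h : TailEquiv (shift q N) α) (h' : TailEquiv q α) :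
    ed K q N • Chen.of K α ⟨shift q N, h⟩ = Chen.of K α ⟨q, h'⟩ := by
  induction N with
  | zero => rw [ed, one_smul]; rfl
  | succ N ih =>
    have h1 : TailEquiv (shift q N) α := (shift_tailEquiv q N).trans h'
    rw [ed, mul_smul, edge_smul_of, ← ih h1]
    congr 3
    have : shift q (N + 1) = (shift q N).tail := by
      funext i
      simp only [shift, InfPath.tail]
      congr 1
      ring
    have h2 := cons_tail (shift q N)
    rw [← this, show shift q N 0 = q N by simp [shift]] at h2
    exact h2

theorem gh_smul_of (q : InfPath n) (N : ℕ) (h : TailEquiv (shift q N) α) (h' : TailEquiv q α) :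
    gh K q N • Chen.of K α ⟨q, h'⟩ = Chen.of K α ⟨shift q N, h⟩ := by
  rw [← ed_smul_of K q N h h', ← mul_smul, gh_mul_ed, one_smul]

theorem conc_of (q : {q : InfPath n // TailEquiv q α}) : Conc K q.1 (Chen.of K α q) := fun N => by
  have h := (shift_tailEquiv q.1 N).trans q.2
  exact (congrArg _ (gh_smul_of K q.1 N h q.2)).trans (ed_smul_of K q.1 N h q.2)

theorem of_ne_zero (q : {q : InfPath n // TailEquiv q α}) : Chen.of K α q ≠ 0 :=
  Finsupp.single_ne_zero.2 one_ne_zero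

variable (α)

theorem Chen.smul_of (k : K) (q : {q : InfPath n // TailEquiv q α}) :
    k • Chen.of K α q = Finsupp.single q k :=
  (Finsupp.smul_single _ _ _).trans (by simp)

@[elab_as_elim]
theorem chen_induction {P : Chen K α → Prop} (y : Chen K α) (zero : P 0)
    (add : ∀ x y, P x → P y → P (x + y)) (smul_of : ∀ (k : K) q, P (k • Chen.of K α q)) : P y :=
  Finsupp.induction_linear y zero add fun q k => Chen.smul_of K α k q ▸ smul_of k q

theorem of_generates (y : Chen K α) :
    ∃ r : LPA K n, r • Chen.of K α ⟨α, .refl α⟩ = y := by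
  induction y using chen_induction with
  | zero => exact ⟨0, zero_smul _ _⟩
  | add x y hx hy =>
    obtain ⟨r, hr⟩ := hx
    obtain ⟨s, hs⟩ := hy
    exact ⟨r + s, by rw [add_smul, hr, hs]⟩
  | smul_of k q =>
    obtain ⟨q, a, b, h⟩ := q
    have hq : shift q a = shift α b := funext h
    refine ⟨k • (ed K q a * gh K α b), ?_⟩
    rw [smul_assoc, mul_smul, gh_smul_of K α b (shift_tailEquiv α b)]
    have h1 : (⟨shift α b, shift_tailEquiv α b⟩ : {q : InfPath n // TailEquiv q α}) =
        ⟨shift q a, hq ▸ shift_tailEquiv α b⟩ := Subtype.ext hq.symm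
    rw [h1, ed_smul_of K q a _ ⟨a, b, h⟩]

variable {α}

theorem chen_isSimpleModule (hα : ¬ IsRational α) : IsSimpleModule (LPA K n) (Chen K α) := by
  have hc := conc_of K (⟨α, .refl α⟩ : {q : InfPath n // TailEquiv q α})
  refine hc.isSimpleModule (of_ne_zero K _) (of_generates K α) fun y hy hy0 => ?_
  -- Irrationality forces `a = b`, so each spanning element is `q_a q_a^* z = z`.
  have hle : isotropySpan K α (Chen.of K α ⟨α, .refl α⟩) ≤
      Submodule.span K {Chen.of K α ⟨α, .refl α⟩} := by
    refine Submodule.span_le.2 ?_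
    rintro _ ⟨a, b, hab, rfl⟩
    obtain rfl := shift_injective_of_not_isRational hα hab
    rw [hc]
    exact Submodule.mem_span_singleton_self _
  obtain ⟨k, rfl⟩ := Submodule.mem_span_singleton.1 (hle hy)
  have hk : k ≠ 0 := by
    rintro rfl
    exact hy0 (zero_smul _ _)
  refine ⟨algebraMap K _ k⁻¹, ?_⟩
  rw [algebraMap_smul, smul_smul, inv_mul_cancel₀ hk, one_smul]

theorem chen_finite_supp (y : Chen K α) : (supp K (n := n) y).Finite :=
  finite_supp (conc_of K ⟨α, .refl α⟩) (of_generates K α) y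

theorem chen_tailEquiv_of_mem_supp {y : Chen K α} {r : InfPath n} (hr : r ∈ supp K y) :
    TailEquiv r α :=
  tailEquiv_of_mem_supp (conc_of K ⟨α, .refl α⟩) (of_generates K α) hr

theorem self_mem_supp_of : α ∈ supp K (Chen.of K α ⟨α, .refl α⟩) := fun N => by
  rw [gh_smul_of K α N (shift_tailEquiv α N)]
  exact of_ne_zero K _

/-- The path `α` lies in the support of its basis element, and every support in the other module
stays in the class of `β`. Conversely, tail-equivalent paths give the same basis with the same
action. -/
theorem chen_equiv_iff {β : InfPath n} :
    Nonempty (Chen K α ≃ₗ[LPA K n] Chen K β) ↔ TailEquiv α β := by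
  constructor
  · rintro ⟨e⟩
    have h := self_mem_supp_of K (α := α)
    rw [← supp_equiv e] at h
    exact chen_tailEquiv_of_mem_supp K h
  · intro h
    let e : Chen K α ≃ₗ[K] Chen K β := Finsupp.domLCongr (Equiv.subtypeEquivRight fun q =>
      ⟨fun h' => h'.trans h, fun h' => h'.trans h.symm⟩)
    have he : ∀ q, e (Chen.of K α q) = Chen.of K β ⟨q.1, q.2.trans h⟩ := fun q =>
      Finsupp.domLCongr_single _ _ _
    have hE : ∀ (i : Fin n) y, e (edge K i • y) = edge K i • e y := by
      intro i y
      induction y using chen_induction with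
      | zero => simp
      | add x y hx hy => rw [smul_add, map_add, map_add, smul_add, hx, hy]
      | smul_of k q =>
        rw [smul_comm, map_smul, edge_smul_of, he, map_smul, he, smul_comm, edge_smul_of]
    have hG : ∀ (i : Fin n) y, e (ghost K i • y) = ghost K i • e y := by
      intro i y
      induction y using chen_induction with
      | zero => simp
      | add x y hx hy => rw [smul_add, map_add, map_add, smul_add, hx, hy]
      | smul_of k q =>
        rw [smul_comm, map_smul, ghost_smul_of, map_smul, he, smul_comm, ghost_smul_of]
        split_ifs
        · rw [he]
        · rw [map_zero]
    refine ⟨{ e with map_smul' := fun r => ?_ }⟩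
    refine LPA_induction (P := fun r => ∀ y, e (r • y) = r • e y) ?_ hE hG ?_ ?_ r
    · intro k y
      rw [algebraMap_smul, algebraMap_smul, map_smul]
    · intro a b ha hb y
      rw [add_smul, map_add, ha, hb, add_smul]
    · intro a b ha hb y
      rw [mul_smul, ha, hb, mul_smul]

end ChenModule

/-! ### Periods and rotations of simple closed paths -/

section Periodic

variable {n : ℕ}

theorem powInf_apply {c : List (Fin n)} (hc : c ≠ []) {i : ℕ} (hi : i < c.length) :
    powInf c hc i = (c)[i] := by
  simp [powInf, Nat.mod_eq_of_lt hi]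

theorem map_range_powInf {c : List (Fin n)} (hc : c ≠ []) :
    (List.range c.length).map (powInf c hc) = c := by
  refine List.ext_getElem (by simp) fun i h1 h2 => ?_
  simp [powInf_apply hc h2]

theorem shift_powInf_mul_length {c : List (Fin n)} (hc : c ≠ []) (k : ℕ) :
    shift (powInf c hc) (c.length * k) = powInf c hc := by
  funext i
  simp [shift, powInf]

theorem periodic_mul {q : InfPath n} {t : ℕ} (h : ∀ i, q (i + t) = q i) (k i : ℕ) :
    q (i + t * k) = q i := by
  induction k with
  | zero => simp
  | succ k ih => rw [mul_add, mul_one, ← add_assoc, h, ih]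

theorem periodic_gcd {q : InfPath n} (a b : ℕ) (ha : ∀ i, q (i + a) = q i)
    (hb : ∀ i, q (i + b) = q i) (i : ℕ) : q (i + a.gcd b) = q i := by
  induction a, b using Nat.gcd.induction with
  | H0 b => simpa using hb i
  | H1 a b _ ih =>
    rw [Nat.gcd_rec]
    refine ih (fun i => ?_) ha
    have h := hb i
    rw [← Nat.mod_add_div b a, ← add_assoc, periodic_mul ha] at h
    exact h

theorem flatten_replicate_map_range {q : InfPath n} {g : ℕ} (h : ∀ i, q (i + g) = q i) (k : ℕ) :
    (List.replicate k ((List.range g).map q)).flatten = (List.range (g * k)).map q := by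
  induction k with
  | zero => simp
  | succ k ih =>
    rw [List.replicate_succ', List.flatten_append, ih, mul_add, mul_one, List.range_add]
    simp only [List.flatten_cons, List.flatten_nil, List.append_nil, List.map_append,
      List.map_map, List.append_cancel_left_eq]
    refine List.map_congr_left fun i _ => ?_
    rw [Function.comp, add_comm, periodic_mul h]

/-- The gcd of `t` and the length of `c` is again a period, so `c` is a power of its initial part of
that length; simplicity makes the exponent `1`. -/
theorem IsSCP.length_dvd {c : List (Fin n)} (hc : IsSCP c) {t : ℕ}
    (h : shift (powInf c hc.1) t = powInf c hc.1) : c.length ∣ t := by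
  have hm : 0 < c.length := List.length_pos_of_ne_nil hc.1
  have hg := periodic_gcd c.length t
    (fun i => by simpa [shift] using congrFun (shift_powInf_mul_length hc.1 1) i) (congrFun h)
  obtain ⟨k, hk⟩ := Nat.gcd_dvd_left c.length t
  have hgpos : 0 < c.length.gcd t := Nat.gcd_pos_of_pos_left _ hm
  have hfl := flatten_replicate_map_range hg k
  rw [← hk, map_range_powInf] at hfl
  have hk2 : ¬ 2 ≤ k := fun h2 => hc.2 _ k (by simpa using hgpos.ne') h2 hfl.symm
  have hk1 : k = 1 := by
    rcases Nat.eq_zero_or_pos k with rfl | h0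
    · simp [hc.1] at hk
    · omega
  rw [hk1, mul_one] at hk
  rw [hk]
  exact Nat.gcd_dvd_right _ _

theorem shift_powInf_shift {c : List (Fin n)} (hc : c ≠ []) (a : ℕ) :
    ∃ t, ∀ i, shift (powInf c hc) a (i + t) = powInf c hc i := by
  refine ⟨c.length * a - a, fun i => ?_⟩
  have h1 : a ≤ c.length * a := Nat.le_mul_of_pos_left _ (List.length_pos_of_ne_nil hc)
  rw [shift, add_assoc, Nat.sub_add_cancel h1]
  exact congrFun (shift_powInf_mul_length hc a) i

theorem IsSCP.length_dvd_of_shift_eq {c : List (Fin n)} (hc : IsSCP c) {a t : ℕ}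
    (h : shift (powInf c hc.1) (a + t) = shift (powInf c hc.1) a) : c.length ∣ t := by
  obtain ⟨s, hs⟩ := shift_powInf_shift hc.1 a
  refine hc.length_dvd (funext fun i => ?_)
  have := congrFun h (i + s)
  rw [hs] at this
  rw [← this, shift, ← hs]
  simp only [shift]
  congr 1
  ring

theorem IsSCP.modEq_of_shift_eq {c : List (Fin n)} (hc : IsSCP c) {a b : ℕ}
    (h : shift (powInf c hc.1) a = shift (powInf c hc.1) b) : a ≡ b [MOD c.length] := by
  wlog hab : a ≤ b generalizing a b
  · exact (this h.symm (by omega)).symm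
  obtain ⟨t, rfl⟩ := Nat.exists_eq_add_of_le hab
  have := hc.length_dvd_of_shift_eq h.symm
  exact (Nat.modEq_iff_dvd' hab).2 (by simpa using this)

theorem IsSCP.isRotated_of_tailEquiv {c d : List (Fin n)} (hc : IsSCP c) (hd : IsSCP d)
    (h : TailEquiv (powInf c hc.1) (powInf d hd.1)) : List.IsRotated c d := by
  obtain ⟨a, b, h⟩ := h
  have hab : shift (powInf c hc.1) a = shift (powInf d hd.1) b := funext h
  have hlen : c.length = d.length := by
    refine Nat.dvd_antisymm (hc.length_dvd_of_shift_eq (a := a) ?_)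
      (hd.length_dvd_of_shift_eq (a := b) ?_)
    · rw [← shift_shift, hab, shift_shift, add_comm, ← shift_shift]
      conv_lhs => rw [← mul_one d.length, shift_powInf_mul_length]
    · rw [← shift_shift, ← hab, shift_shift, add_comm, ← shift_shift]
      conv_lhs => rw [← mul_one c.length, shift_powInf_mul_length]
  obtain ⟨s, hs⟩ := shift_powInf_shift hd.1 b
  refine ⟨s + a, List.ext_getElem (by simpa using hlen) fun i h1 h2 => ?_⟩
  rw [List.getElem_rotate, ← powInf_apply hd.1 h2, ← hs, ← hab, shift, add_assoc]
  rfl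

/-- Here `e_2` occurs only as the last edge, and a nontrivial rotation would move it to an earlier
position. -/
theorem IsCs.eq_of_isRotated {hn : 2 ≤ n} {c d : List (Fin n)} (hc : IsCs hn c) (hd : IsCs hn d)
    (h : List.IsRotated c d) : c = d := by
  obtain ⟨k, hk⟩ := h
  obtain ⟨-, l, rfl, hl⟩ := hc
  obtain ⟨-, l', rfl, hl'⟩ := hd
  have hlen : l.length = l'.length := by simpa using congrArg List.length hk
  rw [← List.rotate_mod] at hk
  set j := k % (l ++ [i₂ hn]).length with hj
  have hjlt : j < l.length + 1 := by
    have := Nat.mod_lt k (show 0 < (l ++ [i₂ hn]).length by simp)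
    rw [← hj] at this
    simpa using this
  rcases Nat.eq_zero_or_pos j with h0 | hpos
  · rwa [h0, List.rotate_zero] at hk
  exfalso
  have hlt : l.length - j < (l' ++ [i₂ hn]).length := by simp; omega
  have hlt' : l.length - j < l'.length := by omega
  have h1 : (l' ++ [i₂ hn])[l.length - j] = i₂ hn := by
    have h2 := List.getElem_rotate (l ++ [i₂ hn]) j (l.length - j) (by simp)
    have h3 : (l.length - j + j) % (l ++ [i₂ hn]).length = l.length := by
      rw [Nat.sub_add_cancel (by omega)]
      exact Nat.mod_eq_of_lt (by simp)
    simp only [h3, hk] at h2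
    rw [h2]
    simp
  rw [List.getElem_append_left hlt'] at h1
  exact hl' _ (List.getElem_mem _) h1

end Periodic

open Polynomial

/-! ### Elements annihilated by `f(c)` -/

section Annihilated

variable {K : Type*} [Field K] {n : ℕ} {M : Type*} [AddCommGroup M] [Module (LPA K n) M]

theorem ed_powInf_mul_length {c : List (Fin n)} (hc : c ≠ []) (k : ℕ) :
    ed K (powInf c hc) (c.length * k) = pathElt K c ^ k := by
  induction k with
  | zero => simp [ed]
  | succ k ih =>
    rw [mul_add, mul_one, ed_add, ih, shift_powInf_mul_length, ed_eq_pathElt, map_range_powInf,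
      pow_succ]

theorem aeval_mul_smul (x : LPA K n) (g h : K[X]) (z : M) :
    aeval x (g * h) • z = aeval x g • aeval x h • z := by
  rw [map_mul, mul_smul]

theorem aeval_smul_comm (x : LPA K n) (g h : K[X]) (z : M) :
    aeval x g • aeval x h • z = aeval x h • aeval x g • z := by
  rw [← aeval_mul_smul, mul_comm, aeval_mul_smul]

variable {f : K[X]} {c : List (Fin n)} {z : M}

/-- Since `f` has constant term `1`, `1 - f = X * (-f.divX)`. Hence `-f.divX`, evaluated at `c`,
inverts `c` on `z`, and `c^*` acts on `z` as this polynomial in `c`. -/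
theorem eq_pathElt_pow_smul (hf : f.coeff 0 = 1) (h : aeval (pathElt K c) f • z = 0) (j : ℕ) :
    z = pathElt K c ^ j • aeval (pathElt K c) ((-f.divX) ^ j) • z := by
  have h1 : z = aeval (pathElt K c) (X * -f.divX) • z := by
    conv_rhs => rw [show X * -f.divX = 1 - f by
      conv_rhs => rw [← X_mul_divX_add f, hf]
      simp]
    rw [map_sub, sub_smul, h, map_one, one_smul, sub_zero]
  have h2 : z = aeval (pathElt K c) ((X * -f.divX) ^ j) • z := by
    induction j with
    | zero => simp
    | succ j ih => rw [pow_succ, aeval_mul_smul, ← h1, ← ih]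
  rw [mul_pow, aeval_mul_smul, map_pow, aeval_X] at h2
  exact h2

theorem conc_of_aeval_smul_eq_zero (hc : c ≠ []) (hf : f.coeff 0 = 1)
    (h : aeval (pathElt K c) f • z = 0) : Conc K (powInf c hc) z := by
  intro N
  have hle : N ≤ c.length * N := Nat.le_mul_of_pos_left _ (List.length_pos_of_ne_nil hc)
  obtain ⟨t, ht⟩ := Nat.exists_eq_add_of_le hle
  rw [eq_pathElt_pow_smul hf h N, ← ed_powInf_mul_length hc, ht, ed_add]
  simp only [← mul_smul, mul_assoc]
  rw [← mul_assoc (gh K _ N), gh_mul_ed, one_mul]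

theorem gh_powInf_smul (hc : c ≠ []) (hf : f.coeff 0 = 1)
    (h : aeval (pathElt K c) f • z = 0) (j : ℕ) :
    gh K (powInf c hc) (c.length * j) • z = aeval (pathElt K c) ((-f.divX) ^ j) • z := by
  conv_lhs => rw [eq_pathElt_pow_smul hf h j, ← ed_powInf_mul_length hc, ← mul_smul, gh_mul_ed,
    one_smul]

theorem exists_aeval_smul_of_mem_isotropySpan [Module K M] [IsScalarTower K (LPA K n) M]
    (hc : IsSCP c) (hf : f.coeff 0 = 1)
    (h : aeval (pathElt K c) f • z = 0) {y : M} (hy : y ∈ isotropySpan K (powInf c hc.1) z) :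
    ∃ g : K[X], y = aeval (pathElt K c) g • z := by
  have hz := conc_of_aeval_smul_eq_zero hc.1 hf h
  induction hy using Submodule.span_induction with
  | mem y hy =>
    obtain ⟨a, b, hab, rfl⟩ := hy
    have hm : 0 < c.length := List.length_pos_of_ne_nil hc.1
    -- Both `a` and `b` are extended by the same `t` edges to whole numbers of turns around `c`: `b
    -- + t` is `b` turns, and `a + t` is also a multiple because `a ≡ b`.
    have hb : b ≤ c.length * b := Nat.le_mul_of_pos_left _ hm
    obtain ⟨t, ht⟩ := Nat.exists_eq_add_of_le hb
    have ha : c.length ∣ a + t := by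
      have h1 : a + t ≡ b + t [MOD c.length] := (hc.modEq_of_shift_eq hab).add_right t
      rw [← ht] at h1
      exact (Nat.modEq_zero_iff_dvd).1 (h1.trans (by simp [Nat.ModEq]))
    obtain ⟨i, hi⟩ := ha
    refine ⟨X ^ i * (-f.divX) ^ b, ?_⟩
    rw [hz.gh_smul_eq b t, ← hab, ← mul_smul, ← ed_add, hi, ← ht, ed_powInf_mul_length,
      gh_powInf_smul hc.1 hf h, aeval_mul_smul, aeval_X_pow]
  | zero => exact ⟨0, by simp⟩
  | add x y _ _ hx hy =>
    obtain ⟨g, rfl⟩ := hx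
    obtain ⟨g', rfl⟩ := hy
    exact ⟨g + g', by rw [map_add, add_smul]⟩
  | smul k y _ hy =>
    obtain ⟨g, rfl⟩ := hy
    exact ⟨k • g, by rw [map_smul, smul_assoc]⟩

theorem aeval_smul_eq_zero_of_isCoprime {x : LPA K n} {g : K[X]} (hfg : IsCoprime f g)
    (hf : aeval x f • z = 0) (hg : aeval x g • z = 0) : z = 0 := by
  obtain ⟨a, b, hab⟩ := hfg
  have : aeval x (a * f + b * g) • z = z := by rw [hab, map_one, one_smul]
  rw [← this, map_add, add_smul, aeval_mul_smul, aeval_mul_smul, hf, hg, smul_zero, smul_zero,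
    add_zero]

end Annihilated

/-! ### The left ideal generated by `f(c)` is proper -/

section GeneratorNeZero

variable (K : Type*) [Field K] {n : ℕ}

/-- Extension of scalars from `K` to `L` maps `L_K(R_n)` to `L_L(R_n)`, and the edges may be
rescaled by a unit of `L`. -/
theorem exists_scaled_hom (L : Type*) [Field L] [Algebra K L] {u : L} (hu : u ≠ 0) :
    ∃ φ : LPA K n →+* LPA L n, (∀ i, φ (edge K i) = u • edge L i) ∧
      ∀ k, φ (algebraMap K _ k) = algebraMap L _ (algebraMap K L k) := by
  let _ : Algebra K (LPA L n) := Algebra.compHom _ (algebraMap K L)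
  have h1 : ∀ i j : Fin n, (u⁻¹ • ghost L i) * (u • edge L j) = if i = j then 1 else 0 := by
    intro i j
    rw [smul_mul_smul_comm, inv_mul_cancel₀ hu, one_smul, ghost_mul_edge]
  have h2 : ∑ i : Fin n, (u • edge L i) * (u⁻¹ • ghost L i) = 1 := by
    simp_rw [smul_mul_smul_comm, mul_inv_cancel₀ hu, one_smul]
    exact sum_edge_mul_ghost L
  exact ⟨(lift K (fun i => u • edge L i) (fun i => u⁻¹ • ghost L i) h1 h2).toRingHom,
    fun i => lift_edge K _ _ h1 h2 i,
    fun k => AlgHom.commutes (lift K (fun i => u • edge L i) (fun i => u⁻¹ • ghost L i) h1 h2) k⟩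

theorem map_pathElt_of_scaled {L : Type*} [Field L] {u : L} {φ : LPA K n →+* LPA L n}
    (hφ : ∀ i, φ (edge K i) = u • edge L i) (c : List (Fin n)) :
    φ (pathElt K c) = u ^ c.length • pathElt L c := by
  induction c with
  | nil => simp [pathElt]
  | cons i c ih =>
    simp only [pathElt, List.map_cons, List.prod_cons, map_mul, List.length_cons] at ih ⊢
    rw [ih, hφ, smul_mul_smul_comm, pow_succ']

/-- Let `x` be a root of `f` in the algebraic closure. With edges rescaled by `u`, where `u ^
c.length = x`, the path `c` multiplies the basis vector `c^∞` by `x`; so `f(c)` kills this vector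
and `1` does not. -/
theorem one_ne_mul_aeval {f : K[X]} (hf : IsIrr f) {c : List (Fin n)} (hc : c ≠ [])
    (r : LPA K n) : 1 ≠ r * aeval (pathElt K c) f := by
  intro h
  obtain ⟨x, hx⟩ := IsAlgClosed.exists_aeval_eq_zero (AlgebraicClosure K) f
    (degree_pos_of_irreducible hf.1).ne'
  have hx0 : x ≠ 0 := by
    rintro rfl
    rw [← coeff_zero_eq_aeval_zero', hf.2, map_one] at hx
    exact one_ne_zero hx
  have hm : 0 < c.length := List.length_pos_of_ne_nil hc
  obtain ⟨u, hu⟩ := IsAlgClosed.exists_pow_nat_eq x hm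
  have hu0 : u ≠ 0 := by
    rintro rfl
    rw [zero_pow hm.ne'] at hu
    exact hx0 hu.symm
  obtain ⟨φ, hφ, hφK⟩ := exists_scaled_hom K (n := n) (AlgebraicClosure K) hu0
  set q := powInf c hc
  set v : Chen (AlgebraicClosure K) q := Chen.of _ q ⟨q, .refl q⟩
  have hcv : pathElt (AlgebraicClosure K) c • v = v := by
    have h1 := ed_powInf_mul_length (K := AlgebraicClosure K) hc 1
    rw [pow_one, mul_one] at h1
    have h2 := shift_powInf_mul_length hc 1
    rw [mul_one] at h2
    have h3 := ed_smul_of (AlgebraicClosure K) q c.length (shift_tailEquiv _ _) (.refl q)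
    rw [← h1]
    exact (congrArg (ed _ q c.length • Chen.of _ q ·) (Subtype.ext h2.symm)).trans h3
  have hev : ∀ g : K[X], φ (aeval (pathElt K c) g) • v = aeval x g • v := by
    intro g
    induction g using Polynomial.induction_on with
    | C a => rw [aeval_C, aeval_C, hφK, algebraMap_smul]
    | add p q hp hq => simp only [map_add, add_smul, hp, hq]
    | monomial k a ih =>
      rw [pow_succ', mul_left_comm, map_mul (aeval _) X, map_mul (aeval _) X, map_mul φ, mul_smul,
        ih, aeval_X, map_pathElt_of_scaled K hφ, hu, smul_assoc, smul_comm _ (aeval x _), hcv,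
        smul_smul, aeval_X]
  have h1 := congrArg (fun r => φ r • v) h
  simp only [map_one, one_smul, map_mul, mul_smul] at h1
  rw [hev, hx, zero_smul, smul_zero] at h1
  exact of_ne_zero _ _ h1

end GeneratorNeZero

/-! ### The modules `S^f_c` -/

section SModule

variable {K : Type*} [Field K] {n : ℕ}

/-- The canonical generator of `S^f_c`. -/
noncomputable def SModule.gen (f : K[X]) (c : List (Fin n)) : SModule f c :=
  Submodule.Quotient.mk 1

theorem smul_gen (f : K[X]) (c : List (Fin n)) (r : LPA K n) :
    r • SModule.gen f c = Submodule.Quotient.mk r := by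
  rw [SModule.gen, ← Submodule.Quotient.mk_smul, smul_eq_mul, mul_one]

theorem gen_generates (f : K[X]) (c : List (Fin n)) (y : SModule f c) :
    ∃ r : LPA K n, r • SModule.gen f c = y := by
  obtain ⟨r, rfl⟩ := Submodule.Quotient.mk_surjective _ y
  exact ⟨r, smul_gen f c r⟩

theorem smul_gen_eq_zero_iff {f : K[X]} {c : List (Fin n)} {r : LPA K n} :
    r • SModule.gen f c = 0 ↔ ∃ s, r = s * aeval (pathElt K c) f := by
  rw [smul_gen, Submodule.Quotient.mk_eq_zero, Submodule.mem_span_singleton]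
  simp only [smul_eq_mul, eq_comm]

theorem aeval_smul_gen (f : K[X]) (c : List (Fin n)) :
    aeval (pathElt K c) f • SModule.gen f c = 0 :=
  smul_gen_eq_zero_iff.2 ⟨1, (one_mul _).symm⟩

/-- An annihilator of the generator is a left multiple of `f(c)`, which commutes with `g(c)`. -/
theorem smul_aeval_smul_gen {f : K[X]} {c : List (Fin n)} {r : LPA K n}
    (h : r • SModule.gen f c = 0) (g : K[X]) :
    r • aeval (pathElt K c) g • SModule.gen f c = 0 := by
  obtain ⟨s, rfl⟩ := smul_gen_eq_zero_iff.1 h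
  rw [mul_smul, aeval_smul_comm, aeval_smul_gen, smul_zero, smul_zero]

variable {f : K[X]} {c : List (Fin n)}

theorem gen_ne_zero (hf : IsIrr f) (hc : c ≠ []) : SModule.gen f c ≠ 0 := by
  intro h
  rw [← one_smul (LPA K n) (SModule.gen f c)] at h
  obtain ⟨s, hs⟩ := smul_gen_eq_zero_iff.1 h
  exact one_ne_mul_aeval K hf hc s hs

theorem conc_gen (hf : IsIrr f) (hc : c ≠ []) : Conc K (powInf c hc) (SModule.gen f c) :=
  conc_of_aeval_smul_eq_zero hc hf.2 (aeval_smul_gen f c)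

theorem sModule_isSimpleModule (hf : IsIrr f) (hc : IsSCP c) :
    IsSimpleModule (LPA K n) (SModule f c) := by
  refine (conc_gen hf hc.1).isSimpleModule (gen_ne_zero hf hc.1) (gen_generates f c)
    fun y hy hy0 => ?_
  obtain ⟨g, rfl⟩ := exists_aeval_smul_of_mem_isotropySpan hc hf.2 (aeval_smul_gen f c) hy
  have hfg : IsCoprime f g := by
    refine hf.1.coprime_iff_not_dvd.2 ?_
    rintro ⟨t, rfl⟩
    rw [mul_comm, aeval_mul_smul, aeval_smul_gen, smul_zero] at hy0
    exact hy0 rfl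
  obtain ⟨a, b, hab⟩ := hfg
  refine ⟨aeval (pathElt K c) b, ?_⟩
  have : aeval (pathElt K c) (a * f + b * g) • SModule.gen f c = SModule.gen f c := by
    rw [hab, map_one, one_smul]
  rwa [map_add, add_smul, aeval_mul_smul, aeval_smul_gen, smul_zero, zero_add,
    aeval_mul_smul] at this

theorem sModule_finite_supp (hf : IsIrr f) (hc : c ≠ []) (y : SModule f c) :
    (supp K (n := n) y).Finite :=
  finite_supp (conc_gen hf hc) (gen_generates f c) y

theorem sModule_tailEquiv_of_mem_supp (hf : IsIrr f) (hc : c ≠ []) {y : SModule f c}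
    {r : InfPath n} (hr : r ∈ supp K y) : TailEquiv r (powInf c hc) :=
  tailEquiv_of_mem_supp (conc_gen hf hc) (gen_generates f c) hr

/-- A nonzero element annihilated by `f(c)` identifies a simple module with `S^f_c`. -/
theorem nonempty_sModule_equiv {N : Type*} [AddCommGroup N] [Module (LPA K n) N]
    [IsSimpleModule (LPA K n) N] (hf : IsIrr f) (hc : IsSCP c) {y : N} (hy0 : y ≠ 0)
    (hy : aeval (pathElt K c) f • y = 0) : Nonempty (SModule f c ≃ₗ[LPA K n] N) := by
  have := sModule_isSimpleModule hf hc
  let φ : SModule f c →ₗ[LPA K n] N := Submodule.liftQ _ (LinearMap.toSpanSingleton (LPA K n) N y)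
    (by
      rw [Submodule.span_singleton_le_iff_mem, LinearMap.mem_ker]
      exact hy)
  have hφ : φ (SModule.gen f c) = y := by
    change (1 : LPA K n) • y = y
    exact one_smul _ _
  have hφ0 : φ ≠ 0 := by
    intro h
    rw [h] at hφ
    exact hy0 hφ.symm
  exact ⟨LinearEquiv.ofBijective φ (LinearMap.bijective_of_ne_zero hφ0)⟩

theorem nonempty_sModule_equiv_of_isRotated {d : List (Fin n)} (hf : IsIrr f) (hc : IsSCP c)
    (hd : IsSCP d) (h : List.IsRotated c d) : Nonempty (SModule f c ≃ₗ[LPA K n] SModule f d) := by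
  obtain ⟨k, hk, rfl⟩ := List.isRotated_iff_mod.1 h
  rw [List.rotate_eq_drop_append_take hk] at hd ⊢
  have := sModule_isSimpleModule hf hd
  set u := c.take k
  set v := c.drop k
  have hcuv : c = u ++ v := (List.take_append_drop k c).symm
  set z := SModule.gen f (v ++ u)
  have hcomm : ∀ g : K[X], aeval (pathElt K c) g * pathElt K u =
      pathElt K u * aeval (pathElt K (v ++ u)) g := by
    intro g
    have h1 : pathElt K c * pathElt K u = pathElt K u * pathElt K (v ++ u) := by
      rw [hcuv, pathElt_append, pathElt_append, mul_assoc]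
    induction g using Polynomial.induction_on with
    | C a => rw [aeval_C, aeval_C, Algebra.commutes]
    | add p q hp hq => rw [map_add, map_add, add_mul, mul_add, hp, hq]
    | monomial k a ih =>
      rw [pow_succ, ← mul_assoc, map_mul _ _ X, map_mul _ _ X, aeval_X, aeval_X, mul_assoc, h1,
        ← mul_assoc, ih, mul_assoc]
  -- With `c = uv` and the rotation `vu`, the identity `c u = u (vu)` gives `f(c) u z = u f(vu) z =
  -- 0`.
  refine nonempty_sModule_equiv (y := pathElt K u • z) hf hc ?_ ?_
  · intro h0
    have hu : ∃ a : LPA K n, a * pathElt K u = 1 := by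
      clear * -
      induction u with
      | nil => exact ⟨1, by simp [pathElt]⟩
      | cons i u ih =>
        obtain ⟨a, ha⟩ := ih
        refine ⟨a * ghost K i, ?_⟩
        have : pathElt K (i :: u) = edge K i * pathElt K u := by simp [pathElt]
        rw [this, mul_assoc, ← mul_assoc (ghost K i), ghost_mul_edge_self, one_mul, ha]
    obtain ⟨a, ha⟩ := hu
    apply gen_ne_zero hf hd.1
    rw [← one_smul (LPA K n) (SModule.gen f _), ← ha, mul_smul, h0, smul_zero]
  · rw [← mul_smul, hcomm, mul_smul, aeval_smul_gen, smul_zero]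

theorem IsIrr.eq_of_not_isCoprime {g : K[X]} (hf : IsIrr f) (hg : IsIrr g)
    (h : ¬ IsCoprime f g) : f = g := by
  have hdvd : f ∣ g := by
    by_contra h'
    exact h (hf.1.coprime_iff_not_dvd.2 h')
  obtain ⟨u, hu⟩ := (hf.1.associated_of_dvd hg.1 hdvd)
  obtain ⟨a, -, ha⟩ := Polynomial.isUnit_iff.1 u.isUnit
  have h0 := congrArg (coeff · 0) hu
  simp only [← ha, mul_coeff_zero, hf.2, hg.2, coeff_C_zero, one_mul] at h0
  rw [← hu, ← ha, h0, C_1, mul_one]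

theorem sModule_equiv_iff {d : List (Fin n)} {g : K[X]} (hf : IsIrr f) (hg : IsIrr g)
    (hc : IsSCP c) (hd : IsSCP d) :
    Nonempty (SModule f c ≃ₗ[LPA K n] SModule g d) ↔ f = g ∧ List.IsRotated c d := by
  constructor
  · rintro ⟨e⟩
    have hrot : List.IsRotated c d := by
      refine hc.isRotated_of_tailEquiv hd ?_
      obtain ⟨r, hr⟩ := supp_nonempty (K := K) (n := n) (gen_ne_zero hf hc.1)
      have hr' := hr
      rw [← supp_equiv e] at hr'
      exact (sModule_tailEquiv_of_mem_supp hf hc.1 hr).symm.trans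
        (sModule_tailEquiv_of_mem_supp hg hd.1 hr')
    refine ⟨?_, hrot⟩
    -- Over the same `c`, the image of the generator is concentrated at `c^∞`, hence is `t(c)` times
    -- the generator of `S^g_c`. It is killed by both `f(c)` and `g(c)`, so it would vanish if `f`
    -- and `g` were coprime.
    obtain ⟨e'⟩ := nonempty_sModule_equiv_of_isRotated hg hd hc hrot.symm
    set y := e' (e (SModule.gen f c)) with hy
    have hconc : Conc K (powInf c hc.1) y :=
      ((conc_gen hf hc.1).map e.toLinearMap).map e'.toLinearMap
    obtain ⟨t, ht⟩ := exists_aeval_smul_of_mem_isotropySpan hc hg.2 (aeval_smul_gen g c)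
      ((conc_gen hg hc.1).mem_isotropySpan (gen_generates g c) hconc)
    refine hf.eq_of_not_isCoprime hg fun hfg => gen_ne_zero hf hc.1 ?_
    have hy0 : y = 0 := by
      refine aeval_smul_eq_zero_of_isCoprime (x := pathElt K c) hfg ?_ ?_
      · rw [hy, ← map_smul, ← map_smul, aeval_smul_gen, map_zero, map_zero]
      · rw [ht, aeval_smul_comm, aeval_smul_gen, smul_zero]
    simpa [hy] using hy0
  · rintro ⟨rfl, h⟩
    exact nonempty_sModule_equiv_of_isRotated hf hc hd h

end SModule

/-! ### Twisting modules by ring endomorphisms -/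

section TwistGeneral

variable {A M N : Type*} [Ring A] [AddCommGroup M] [Module A M] [AddCommGroup N] [Module A N]

/-- The identity map from `M` to its twist. -/
def Twist.of (σ : A →+* A) : M ≃+ Twist (M := M) σ := AddEquiv.refl M

theorem smul_twist_of (σ : A →+* A) (r : A) (y : M) :
    r • Twist.of σ y = Twist.of σ (σ r • y) := rfl

theorem twist_isSimpleModule {σ : A →+* A} (hσ : Function.Surjective σ) [IsSimpleModule A M] :
    IsSimpleModule A (Twist (M := M) σ) := by
  have h := ‹IsSimpleModule A M›
  rw [isSimpleModule_iff_toSpanSingleton_surjective] at h ⊢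
  refine ⟨h.1, fun y hy x => ?_⟩
  obtain ⟨r, hr⟩ := h.2 y hy x
  obtain ⟨s, rfl⟩ := hσ r
  exact ⟨s, hr⟩

/-- The same additive map serves on both sides: linearity over `τ r` on the right is linearity over
`r` on the left. -/
theorem nonempty_twist_equiv_iff {σ τ ρ : A →+* A} (h : ∀ r, ρ (τ r) = σ r)
    (hτ : Function.Surjective τ) :
    Nonempty (Twist (M := M) σ ≃ₗ[A] Twist (M := N) τ) ↔ Nonempty (Twist (M := M) ρ ≃ₗ[A] N) := by
  constructor
  · rintro ⟨e⟩
    refine ⟨{ ((Twist.of ρ).symm.trans (Twist.of σ)).trans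
      (e.toAddEquiv.trans (Twist.of τ).symm) with map_smul' := fun r y => ?_ }⟩
    obtain ⟨s, rfl⟩ := hτ r
    have h1 := e.map_smul s (Twist.of σ ((Twist.of ρ).symm y))
    rw [smul_twist_of, ← h] at h1
    exact h1
  · rintro ⟨e⟩
    refine ⟨{ ((Twist.of σ).symm.trans (Twist.of ρ)).trans
      (e.toAddEquiv.trans (Twist.of τ)) with map_smul' := fun r y => ?_ }⟩
    have h1 := e.map_smul (τ r) (Twist.of ρ ((Twist.of σ).symm y))
    rw [smul_twist_of, h] at h1
    exact h1

end TwistGeneral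

/-! ### Twists by Anick type automorphisms -/

section AnickTwist

variable {K : Type*} [Field K] {n : ℕ} (hn : 2 ≤ n)

theorem anickHom_anickHom (p : LPA K n) {q : LPA K n} (hq : q ∈ anickSubalgebra K hn)
    (r : LPA K n) : anickHom hn p (anickHom hn q r) = anickHom hn (p + q) r := by
  have h12 := i₁_ne_i₂ hn
  have h : (anickHom hn p).comp (anickHom hn q) = anickHom hn (p + q) := by
    refine algHom_ext K (fun i => ?_) (fun i => ?_)
    · rw [AlgHom.comp_apply, anickHom_edge, anickHom_edge]
      split_ifs with h
      · simp [anickHom_edge, anickHom_fix hn p hq, h12, mul_add, add_assoc]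
      · simp [anickHom_edge, h]
    · rw [AlgHom.comp_apply, anickHom_ghost, anickHom_ghost]
      split_ifs with h
      · simp [anickHom_ghost, anickHom_fix hn p hq, h12.symm, add_mul, sub_sub]
      · simp [anickHom_ghost, h]
  exact DFunLike.congr_fun h r

theorem anick_apply (p : anickSubalgebra K hn) (r : LPA K n) :
    (anick hn p : LPA K n →+* LPA K n) r = anickHom hn (p : LPA K n) r := rfl

theorem anick_surjective (p : anickSubalgebra K hn) :
    Function.Surjective (anick hn p : LPA K n →+* LPA K n) :=
  (anick hn p).surjective

theorem pathElt_mem_anickSubalgebra {l : List (Fin n)} (hl : ∀ k ∈ l, k ≠ i₂ hn) :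
    pathElt K l ∈ anickSubalgebra K hn := by
  refine Subalgebra.list_prod_mem _ fun x hx => ?_
  obtain ⟨k, hk, rfl⟩ := List.mem_map.1 hx
  exact Algebra.subset_adjoin (Or.inl ⟨k, hl k hk, rfl⟩)

variable {hn} {f : K[X]} {d : List (Fin n)} {p : anickSubalgebra K hn}

/-- Writing `d = l e_2` with `l` fixed by `σ_p` gives `σ_p(d) = d + l e_1 p`. -/
theorem anickHom_pathElt_smul_of_smul_eq_zero (hd : IsCs hn d) {M : Type*} [AddCommGroup M]
    [Module (LPA K n) M] {y : M} (hy : (p : LPA K n) • y = 0) :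
    anickHom hn (p : LPA K n) (pathElt K d) • y = pathElt K d • y := by
  obtain ⟨-, l, rfl, hl⟩ := hd
  have h2 : pathElt K [i₂ hn] = edge K (i₂ hn) := by simp [pathElt]
  rw [pathElt_append, map_mul, anickHom_fix hn _ (pathElt_mem_anickSubalgebra hn hl), h2,
    anickHom_edge, if_pos rfl, mul_smul, add_smul, mul_smul, hy, smul_zero, add_zero, mul_smul]

theorem nonempty_sModule_equiv_twistedS (hf : IsIrr f) (hd : IsCs hn d)
    (hp : (p : LPA K n) • SModule.gen f d = 0) :
    Nonempty (SModule f d ≃ₗ[LPA K n] TwistedS hn f d p) := by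
  have := sModule_isSimpleModule hf hd.1
  have : IsSimpleModule (LPA K n) (TwistedS hn f d p) := twist_isSimpleModule (anick_surjective hn p)
  refine nonempty_sModule_equiv hf hd.1 (y := Twist.of _ (SModule.gen f d)) ?_ ?_
  · rw [Ne, EmbeddingLike.map_eq_zero_iff]
    exact gen_ne_zero hf hd.1.1
  · rw [smul_twist_of, EmbeddingLike.map_eq_zero_iff, anick_apply, ← aeval_algHom_apply]
    have key : ∀ g : K[X], aeval (anickHom hn (p : LPA K n) (pathElt K d)) g • SModule.gen f d =
        aeval (pathElt K d) g • SModule.gen f d := by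
      intro g
      induction g using Polynomial.induction_on with
      | C a => rw [aeval_C, aeval_C]
      | add p q hp hq => rw [map_add, map_add, add_smul, add_smul, hp, hq]
      | monomial k a ih =>
        rw [pow_succ', mul_left_comm, map_mul (aeval _) X, map_mul (aeval _) X, mul_smul, mul_smul,
          ih, aeval_X, aeval_X]
        exact anickHom_pathElt_smul_of_smul_eq_zero hd (smul_aeval_smul_gen hp _)
    rw [key, aeval_smul_gen]

/-- At each `e_2` on `d^∞`, the twisted action of `e_1^*` contributes `-p e_2^*`, which opens a
branch off `d^∞`. The branch survives because `p z ≠ 0`, and there is one for each turn around `d`.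
-/
theorem infinite_supp_twist_gen (hf : IsIrr f) (hd : IsCs hn d)
    (hp : (p : LPA K n) • SModule.gen f d ≠ 0) :
    (supp K (n := n) (Twist.of (anick hn p : LPA K n →+* LPA K n) (SModule.gen f d))).Infinite := by
  have h12 := i₁_ne_i₂ hn
  set σ := (anick hn p : LPA K n →+* LPA K n) with hσ
  set z := SModule.gen f d with hz
  set w := powInf d hd.1.1 with hw
  have hcz : Conc K w z := conc_gen hf hd.1.1
  have hgh : ∀ N, gh K w N • Twist.of σ z = Twist.of σ (gh K w N • z) := by
    intro N
    induction N with
    | zero => simp [gh]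
    | succ N ih =>
      rw [gh, mul_smul, ih, smul_twist_of, anick_apply, anickHom_ghost, mul_smul]
      split_ifs with h
      -- Only `e_1^*` is altered by the twist, and its correction `-p e_2^*` vanishes on an element
      -- of the form `e_1 y`.
      · have h1 := hcz.gh_smul_eq N 1
        simp only [ed, shift, one_mul, zero_add] at h1
        rw [h1, h, sub_smul, mul_smul, ← mul_smul (ghost K (i₂ hn)),
          ghost_mul_edge_of_ne K h12.symm, zero_smul, smul_zero, sub_zero]
      · rfl
  obtain ⟨l, hl, hl2⟩ := hd.2
  have hlen : d.length = l.length + 1 := by rw [hl]; simp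
  -- The position of the final `e_2` in turn number `k`, counted from `0`.
  let T : ℕ → ℕ := fun k => d.length * k + l.length
  have hwT : ∀ k, w (T k) = i₂ hn := by
    intro k
    have h1 := congrFun (shift_powInf_mul_length hd.1.1 k) l.length
    rw [powInf_apply hd.1.1 (i := l.length) (by omega)] at h1
    rw [show T k = l.length + d.length * k from add_comm _ _]
    refine h1.trans ?_
    simp [hl]
  have hne : ∀ k, ghost K (i₁ hn) • gh K w (T k) • Twist.of σ z ≠ 0 := by
    intro k h0
    have h1 := hcz.gh_smul_eq (T k) 1
    simp only [ed, shift, one_mul, zero_add, hwT] at h1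
    rw [show T k + 1 = d.length * (k + 1) by simp only [T]; rw [hlen]; ring,
      gh_powInf_smul hd.1.1 hf.2 (aeval_smul_gen f d)] at h1
    rw [hgh, smul_twist_of, anick_apply, anickHom_ghost, if_pos rfl,
      EmbeddingLike.map_eq_zero_iff, h1, sub_smul, ← mul_smul, ghost_mul_edge_of_ne K h12,
      zero_smul, zero_sub, neg_eq_zero, mul_smul, ← mul_smul (ghost K (i₂ hn)),
      ghost_mul_edge_self, one_smul, ← mul_smul] at h0
    -- The hypothesis `h0` says that `p` kills `z` after `k + 1` turns are removed; applying `d ^ (k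
    -- + 1)` to the generator restores these turns and gives `p z = 0`.
    have h2 := smul_aeval_smul_gen h0 (X ^ (k + 1))
    rw [mul_smul, aeval_smul_comm, aeval_X_pow,
      ← eq_pathElt_pow_smul hf.2 (aeval_smul_gen f d)] at h2
    exact hp h2
  have hex : ∀ k, ∃ r ∈ supp K (Twist.of σ z), (∀ i < T k, r i = w i) ∧ r (T k) = i₁ hn := by
    intro k
    obtain ⟨q, hq⟩ := supp_nonempty (K := K) (n := n) (hne k)
    obtain ⟨r, hr, h1, h2⟩ := exists_mem_supp_of_gh w (T k) (cons_mem_supp hq)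
    exact ⟨r, hr, h1, h2 0⟩
  choose R hR hRw hR1 using hex
  -- The path `R k` follows `d^∞` until position `T k` and leaves it there, so distinct turns give
  -- distinct paths.
  have hlt : ∀ a b, a < b → R a ≠ R b := by
    intro a b hab h
    have hT : T a < T b := by
      have : d.length * a < d.length * b := Nat.mul_lt_mul_of_pos_left hab (by omega)
      simp only [T]
      omega
    have := hRw b (T a) hT
    rw [← h, hR1, hwT] at this
    exact h12 this
  refine Set.infinite_of_injective_forall_mem (f := R) (fun a b h => ?_) hR
  rcases lt_trichotomy a b with h' | h' | h'
  · exact absurd h (hlt _ _ h')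
  · exact h'
  · exact absurd h.symm (hlt _ _ h')

theorem anickEquiv_iff_smul_gen {q : anickSubalgebra K hn} :
    AnickEquiv hn f d p q ↔ ((p - q : anickSubalgebra K hn) : LPA K n) • SModule.gen f d = 0 := by
  rw [smul_gen_eq_zero_iff]
  rfl

theorem smul_gen_ne_zero_of_not_anickEquiv (h : ¬ AnickEquiv hn f d 0 p) :
    (p : LPA K n) • SModule.gen f d ≠ 0 := by
  rw [anickEquiv_iff_smul_gen] at h
  simpa using h

theorem infinite_supp_of_equiv {M : Type*} [AddCommGroup M] [Module (LPA K n) M] (hf : IsIrr f)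
    (hd : IsCs hn d) (hp : (p : LPA K n) • SModule.gen f d ≠ 0)
    (e : TwistedS hn f d p ≃ₗ[LPA K n] M) : ∃ y : M, (supp K (n := n) y).Infinite :=
  ⟨e (Twist.of _ (SModule.gen f d)), by
    rw [supp_equiv]
    exact infinite_supp_twist_gen hf hd hp⟩

theorem twistedS_equiv_iff {c : List (Fin n)} {g : K[X]} {q : anickSubalgebra K hn}
    (hc : IsCs hn c) (hd : IsCs hn d) (hf : IsIrr f) (hg : IsIrr g) :
    Nonempty (TwistedS hn f c p ≃ₗ[LPA K n] TwistedS hn g d q) ↔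
      f = g ∧ c = d ∧ AnickEquiv hn f c p q := by
  rw [nonempty_twist_equiv_iff (ρ := (anick hn (p - q) : LPA K n →+* LPA K n)) (fun r => by
    rw [anick_apply, anick_apply, anick_apply, anickHom_anickHom hn _ q.2]
    simp) (anick_surjective hn q), anickEquiv_iff_smul_gen]
  constructor
  · rintro ⟨e⟩
    have h0 : ((p - q : anickSubalgebra K hn) : LPA K n) • SModule.gen f c = 0 := by
      by_contra h
      obtain ⟨y, hy⟩ := infinite_supp_of_equiv hf hc h e
      exact hy (sModule_finite_supp hg hd.1.1 y)
    obtain ⟨e'⟩ := nonempty_sModule_equiv_twistedS hf hc h0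
    obtain ⟨hfg, hrot⟩ := (sModule_equiv_iff hf hg hc.1 hd.1).1 ⟨e'.trans e⟩
    exact ⟨hfg, hc.eq_of_isRotated hd hrot, h0⟩
  · rintro ⟨rfl, rfl, h0⟩
    obtain ⟨e⟩ := nonempty_sModule_equiv_twistedS hf hc h0
    exact ⟨e.symm⟩

end AnickTwist

end Rose

/-! ### Assembly of the classification -/

open Rose
theorem mainTheorem2 (K : Type*) [Field K] (n : ℕ) (hn : 2 ≤ n) :
    -- all the modules in the three families are simple
    (∀ α : InfPath n, ¬ IsRational α → IsSimpleModule (LPA K n) (Chen K α)) ∧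
    (∀ (c : List (Fin n)) (f : K[X]), IsSCP c → IsIrr f →
      IsSimpleModule (LPA K n) (SModule f c)) ∧
    (∀ (d : List (Fin n)) (f : K[X]) (p : anickSubalgebra K hn), IsCs hn d → IsIrr f →
      ¬ AnickEquiv hn f d 0 p → IsSimpleModule (LPA K n) (TwistedS hn f d p)) ∧
    -- inside each family, isomorphic modules have the same index
    (∀ α β : InfPath n, ¬ IsRational α → ¬ IsRational β →
      (Nonempty (Chen K α ≃ₗ[LPA K n] Chen K β) ↔ TailEquiv α β)) ∧
    (∀ (c d : List (Fin n)) (f g : K[X]), IsSCP c → IsSCP d → IsIrr f → IsIrr g →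
      (Nonempty (SModule f c ≃ₗ[LPA K n] SModule g d) ↔ f = g ∧ List.IsRotated c d)) ∧
    (∀ (c d : List (Fin n)) (f g : K[X]) (p q : anickSubalgebra K hn),
      IsCs hn c → IsCs hn d → IsIrr f → IsIrr g →
      ¬ AnickEquiv hn f c 0 p → ¬ AnickEquiv hn g d 0 q →
      (Nonempty (TwistedS hn f c p ≃ₗ[LPA K n] TwistedS hn g d q) ↔
        f = g ∧ c = d ∧ AnickEquiv hn f c p q)) ∧
    -- modules from different families are not isomorphic
    (∀ (α : InfPath n) (c : List (Fin n)) (f : K[X]), ¬ IsRational α → IsSCP c → IsIrr f →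
      IsEmpty (Chen K α ≃ₗ[LPA K n] SModule f c)) ∧
    (∀ (α : InfPath n) (d : List (Fin n)) (f : K[X]) (p : anickSubalgebra K hn),
      ¬ IsRational α → IsCs hn d → IsIrr f → ¬ AnickEquiv hn f d 0 p →
      IsEmpty (Chen K α ≃ₗ[LPA K n] TwistedS hn f d p)) ∧
    (∀ (c d : List (Fin n)) (f g : K[X]) (p : anickSubalgebra K hn),
      IsSCP c → IsCs hn d → IsIrr f → IsIrr g → ¬ AnickEquiv hn g d 0 p →
      IsEmpty (SModule f c ≃ₗ[LPA K n] TwistedS hn g d p)) := by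
  refine ⟨fun α hα => chen_isSimpleModule K hα, fun c f hc hf => sModule_isSimpleModule hf hc,
    fun d f p hd hf _ => ?_, fun α β _ _ => chen_equiv_iff K,
    fun c d f g hc hd hf hg => sModule_equiv_iff hf hg hc hd,
    fun c d f g p q hc hd hf hg _ _ => twistedS_equiv_iff hc hd hf hg, ?_, ?_, ?_⟩
  · have := sModule_isSimpleModule hf hd.1
    exact twist_isSimpleModule (anick_surjective hn p)
  · refine fun α c f hα hc hf => ⟨fun e => hα ⟨c, hc.1, ?_⟩⟩
    have h := self_mem_supp_of K (α := α)
    rw [← supp_equiv e] at h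
    exact sModule_tailEquiv_of_mem_supp hf hc.1 h
  · refine fun α d f p hα hd hf hp => ⟨fun e => ?_⟩
    obtain ⟨y, hy⟩ := infinite_supp_of_equiv hf hd (smul_gen_ne_zero_of_not_anickEquiv hp) e.symm
    exact hy (chen_finite_supp K y)
  · refine fun c d f g p hc hd hf hg hp => ⟨fun e => ?_⟩
    obtain ⟨y, hy⟩ := infinite_supp_of_equiv hg hd (smul_gen_ne_zero_of_not_anickEquiv hp) e.symm
    exact hy (sModule_finite_supp hf hc.1 y)
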